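/- Let $n\ge 1$, $L>0$ and $T^n=(\mathbb R/L\mathbb Z)^n$. Let $\varphi\colon T^n\times\mathbb R\to\mathbb R$ be Lipschitz continuous, with $\varphi(x,y+1)=\varphi(x,y)$ and $\int_{T^n\times[0,1)}\varphi=0$, and let $F\ge 0$. Consider the stationary equation $$0=-(-\Delta)^{1/2}g(x)+\varphi(x,g(x))+F,\qquad x\in T^n. \tag{1}$$ A *weak solution* of (1) is a (real-valued) function $g\in H^{1/2}(T^n)$, i.e. $g\in L^2(T^n)$ with $\sum_{k\in\mathbb Z^n}|k|\,|\hat g(k)|^2<\infty$, such that for every $v\in C^\infty(T^n)$ $$\sum_{k\in\mathbb Z^n}\frac{2\pi|k|}{L}\,\hat g(k)\,\overline{\hat v(k)}=\frac1{L^n}\int_{T^n}\bigl(\varphi(x,g(x))+F\bigr)v(x)\,dx ,\qquad \hat g(k)=\frac1{L^n}\int_{T^n}g(x)e^{-2\pi i k\cdot x/L}\,dx .$$ Identify functions on $T^n$ with periodic functions on $\mathbb R^n$, and let $$(-\Delta)^{1/2}u(x)=-\frac{c_n}{2}\int_{\mathbb R^n}\frac{u(x+y)+u(x-y)-2u(x)}{|y|^{n+1}}\,dy,\qquad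 c_n=\Bigl(\int_{\mathbb R^n}\frac{1-\cos y_1}{|y|^{n+1}}\,dy\Bigr)^{-1}.$$ A *classical solution* of (1) is a function $u\in C^1(T^n)$ such that this integral converges absolutely and (1) holds at every $x$. A *viscosity solution* of (1) is a continuous function $u$ on $T^n$ such that for all $x\in\mathbb R^n$, $r>0$ and $\psi\in C^2(\mathbb R^n)$: if $u-\psi$ attains its maximum over the ball $B_r(x)$ at $x$, then $$\frac{c_n}{2}\Bigl(\int_{|y|<r}\frac{\psi(x+y)+\psi(x-y)-2\psi(x)}{|y|^{n+1}}\,dy+\int_{|y|\ge r}\frac{u(x+y)+u(x-y)-2u(x)}{|y|^{n+1}}\,dy\Bigr)+\varphi(x,u(x))+F\ \ge\ 0,$$ and if $u-\psi$ attains its minimum over $B_r(x)$ at $x$, then the same expression is $\le 0$. **Proposition.** Every weak solution $g$ of (1) agrees almost everywhere with a function $u$ on $T^n$ that is a classical solution of (1) and also a viscosity solution of (1). -/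

import Mathlib

open MeasureTheory
open scoped ContDiff

namespace StickSlip

noncomputable section

/-! The flat torus `T^n = (ℝ / L ℤ)^n` is coordinatised by the unit torus `UnitAddTorus (Fin n)`:
the class of `x ∈ ℝ^n` modulo `L ℤ^n` corresponds to the class of `x / L` modulo `ℤ^n`.
Functions on `T^n` are functions on `UnitAddTorus (Fin n)`; derivatives, frequencies and the
half-Laplacian are those of the torus of side `L`. -/

/-- The covering map `ℝ^n → (ℝ / L ℤ)^n`, in the coordinates above. -/
def cover {n : ℕ} (L : ℝ) (x : EuclideanSpace ℝ (Fin n)) : UnitAddTorus (Fin n) :=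
  fun i => ((x i / L : ℝ) : UnitAddCircle)

/-- The `L ℤ^n`-periodic function on `ℝ^n` that corresponds to a function on the torus. -/
def lift {n : ℕ} (L : ℝ) (u : UnitAddTorus (Fin n) → ℝ) : EuclideanSpace ℝ (Fin n) → ℝ :=
  fun x => u (cover L x)

/-- Haar probability measure on the torus, i.e. normalised Lebesgue measure. This is the measure
with respect to which `UnitAddTorus.mFourierCoeff` is defined. -/
def torusMeasure (n : ℕ) : Measure (UnitAddTorus (Fin n)) :=
  Measure.pi fun _ => AddCircle.haarAddCircle

/-- Fourier coefficient of a real-valued function on the torus. -/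
def coeff {n : ℕ} (u : UnitAddTorus (Fin n) → ℝ) (k : Fin n → ℤ) : ℂ :=
  UnitAddTorus.mFourierCoeff (fun x => (u x : ℂ)) k

/-- The symbol `|2 π k / L|` of `(-Δ)^{1/2}` on the torus of side `L`. -/
def symbol {n : ℕ} (L : ℝ) (k : Fin n → ℤ) : ℝ :=
  2 * Real.pi / L * Real.sqrt (∑ i, (k i : ℝ) ^ 2)

/-- The fractional Sobolev space `H^{1/2}` of the torus: square-integrable functions with
`∑ |2 π k / L| |û(k)|² < ∞`. -/
def MemHHalf {n : ℕ} (L : ℝ) (u : UnitAddTorus (Fin n) → ℝ) : Prop :=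
  MemLp u 2 (torusMeasure n) ∧ Summable fun k : Fin n → ℤ => symbol L k * ‖coeff u k‖ ^ 2

/-- The standing assumption on the force `φ : T^n × ℝ → ℝ`: period `1` in the second variable,
zero average, (jointly) Lipschitz. -/
structure IsWigglyForce {n : ℕ} (φ : UnitAddTorus (Fin n) → ℝ → ℝ) : Prop where
  periodic : ∀ x, Function.Periodic (φ x) 1
  average_zero : ∫ x, (∫ y in (0 : ℝ)..1, φ x y) ∂(torusMeasure n) = 0
  lipschitz : ∃ K, LipschitzWith K fun p : UnitAddTorus (Fin n) × ℝ => φ p.1 p.2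

/-- Weak solution of `0 = -(-Δ)^{1/2} g + φ(x, g) + F`: `g ∈ H^{1/2}` and, for every smooth `v`,
the bilinear form of `(-Δ)^{1/2}` at `(g, v)` equals the (normalised) integral of
`(φ(x, g) + F) v`. -/
structure IsWeakSolution {n : ℕ} (L : ℝ) (φ : UnitAddTorus (Fin n) → ℝ → ℝ) (F : ℝ)
    (g : UnitAddTorus (Fin n) → ℝ) : Prop where
  memHHalf : MemHHalf L g
  weak_eq : ∀ v : UnitAddTorus (Fin n) → ℝ, ContDiff ℝ ∞ (lift L v) →
    HasSum (fun k : Fin n → ℤ => (symbol L k : ℂ) * (coeff g k * star (coeff v k)))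
      ((∫ x, (φ x (g x) + F) * v x ∂(torusMeasure n) : ℝ) : ℂ)

/-- The integrand `(w(x+y) + w(x-y) - 2 w(x)) / |y|^{n+1}` of the half-Laplacian. -/
def diffKernel {n : ℕ} (w : EuclideanSpace ℝ (Fin n) → ℝ) (x y : EuclideanSpace ℝ (Fin n)) : ℝ :=
  (w (x + y) + w (x - y) - 2 * w x) / ‖y‖ ^ (n + 1)

/-- The usual normalising constant `(∫ (1 - cos y₁) / |y|^{n+1} dy)⁻¹` of `(-Δ)^{1/2}` on `ℝ^n`,
which makes `|ξ|` its symbol. -/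
def normConst (n : ℕ) [NeZero n] : ℝ :=
  (∫ y : EuclideanSpace ℝ (Fin n), (1 - Real.cos (y 0)) / ‖y‖ ^ (n + 1))⁻¹

/-- `(-Δ)^{1/2} w (x)` as a singular integral (in its symmetric form). -/
def halfLaplacian {n : ℕ} [NeZero n] (w : EuclideanSpace ℝ (Fin n) → ℝ)
    (x : EuclideanSpace ℝ (Fin n)) : ℝ :=
  -(normConst n / 2) * ∫ y, diffKernel w x y

/-- The singular integral for `(-Δ)^{1/2}` at `x` with the increments of the test function `ψ`
in the ball of radius `r` and those of `w` outside. -/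
def mixedHalfLaplacian {n : ℕ} [NeZero n] (r : ℝ) (ψ w : EuclideanSpace ℝ (Fin n) → ℝ)
    (x : EuclideanSpace ℝ (Fin n)) : ℝ :=
  -(normConst n / 2) * ((∫ y in Metric.ball 0 r, diffKernel ψ x y) +
    ∫ y in (Metric.ball 0 r)ᶜ, diffKernel w x y)

/-- Classical solution: `u` is `C^1`, the integral defining `(-Δ)^{1/2} u` converges absolutely
at every point, and the stationary equation holds at every point. -/
structure IsClassicalSolution {n : ℕ} [NeZero n] (L : ℝ) (φ : UnitAddTorus (Fin n) → ℝ → ℝ)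
    (F : ℝ) (u : UnitAddTorus (Fin n) → ℝ) : Prop where
  contDiff : ContDiff ℝ 1 (lift L u)
  integrable : ∀ x, Integrable (diffKernel (lift L u) x)
  equation : ∀ x, 0 = -halfLaplacian (lift L u) x + φ (cover L x) (u (cover L x)) + F

/-- Continuous viscosity solution of the stationary equation: at a maximum (minimum) point `x`
of `u - ψ` over a ball around `x`, with `ψ` of class `C^2`, the equation holds with `≤` (`≥`)
when `ψ` replaces `u` in the singular part of the integral. -/
structure IsViscositySolution {n : ℕ} [NeZero n] (L : ℝ) (φ : UnitAddTorus (Fin n) → ℝ → ℝ)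
    (F : ℝ) (u : UnitAddTorus (Fin n) → ℝ) : Prop where
  continuous : Continuous u
  subsolution : ∀ (x : EuclideanSpace ℝ (Fin n)) (r : ℝ), 0 < r →
    ∀ ψ : EuclideanSpace ℝ (Fin n) → ℝ, ContDiff ℝ 2 ψ →
      IsMaxOn (fun y => lift L u y - ψ y) (Metric.ball x r) x →
      0 ≤ -mixedHalfLaplacian r ψ (lift L u) x + φ (cover L x) (u (cover L x)) + F
  supersolution : ∀ (x : EuclideanSpace ℝ (Fin n)) (r : ℝ), 0 < r →
    ∀ ψ : EuclideanSpace ℝ (Fin n) → ℝ, ContDiff ℝ 2 ψ →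
      IsMinOn (fun y => lift L u y - ψ y) (Metric.ball x r) x →
      -mixedHalfLaplacian r ψ (lift L u) x + φ (cover L x) (u (cover L x)) + F ≤ 0

end

end StickSlip

/-! The force `f = φ(·, g) + F` is bounded, and testing the weak equation with characters gives `f̂
= 2π|ξ| ĝ`, where `ξ = k / L`. The proof inverts this multiplier explicitly and bootstraps.

The inverse is an average of Gaussian means over the scales `0 < t ≤ 1`. Its multiplier `∫₀¹ exp(-π
t² |ξ|²) dt` differs from `1 / (2|ξ|)` only by a tail of Gaussian size. Hence `g` is `π⁻¹` times
this average of `f`, plus a function whose Fourier coefficients decay like a Gaussian and which is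
therefore a Gaussian mean of a continuous `ρ` (`exists_ae_eq_potential`). The zero mode needs no
separate treatment: it sits in the remainder.

All derivatives fall on the Gaussian. If `f` is bounded, the potential is Hölder of exponent `1/2`
(`exists_potential_holder`). As `φ` is Lipschitz, the force along this representative is again
Hölder of exponent `1/2`, and then the potential has a first-order Taylor expansion with error
`|h|^(5/4)` (`exists_potential_taylor`). This gives `C¹` (`contDiff_one_of_taylor`) and second
differences of order `|y|^(5/4)`, so the singular integral converges absolutely and is continuous in
the base point. Its Fourier coefficients are those of `f`, so the equation holds at every point
(`HasSmallSecondDiff.halfLaplacian_eq`).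

A classical solution is a viscosity solution because a touching test function has larger (or
smaller) second differences at the contact point (`setIntegral_diffKernel_le`). -/

namespace StickSlip

noncomputable section

/-! ### Translation estimates for the Gaussian. -/

section Gaussian

set_option linter.unusedSectionVars false

variable {V : Type*} [NormedAddCommGroup V] [InnerProductSpace ℝ V]

/-- The Gaussian `exp (-π |z|²)`, which has total mass one. -/
def gauss (z : V) : ℝ := Real.exp (-Real.pi * ‖z‖ ^ 2)

/-- An integrable function that dominates the Gaussian together with its first two
derivatives, also when these are translated by at most one or multiplied by polynomial weights. -/
def gaussMajorant (z : V) : ℝ := Real.exp (3 * (2 * Real.pi * ‖z‖ + Real.pi)) * gauss z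

lemma gauss_pos (z : V) : 0 < gauss z := Real.exp_pos _

lemma gaussMajorant_pos (z : V) : 0 < gaussMajorant z := mul_pos (Real.exp_pos _) (gauss_pos z)

@[fun_prop]
lemma continuous_gauss : Continuous (gauss : V → ℝ) := by unfold gauss; fun_prop

@[fun_prop]
lemma continuous_gaussMajorant : Continuous (gaussMajorant : V → ℝ) := by
  unfold gaussMajorant; fun_prop

lemma one_add_norm_le_exp (z : V) : 1 + ‖z‖ ≤ Real.exp (2 * Real.pi * ‖z‖ + Real.pi) := by
  have h1 := Real.add_one_le_exp (2 * Real.pi * ‖z‖ + Real.pi)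
  nlinarith [Real.pi_gt_three, norm_nonneg z]

lemma gauss_le_majorant (z : V) : gauss z ≤ gaussMajorant z := by
  unfold gaussMajorant
  apply le_mul_of_one_le_left (gauss_pos z).le
  apply Real.one_le_exp
  have := Real.pi_pos
  positivity

lemma one_add_norm_pow_mul_gauss_le (z : V) {k : ℕ} (hk : k ≤ 3) :
    (1 + ‖z‖) ^ k * gauss z ≤ gaussMajorant z := by
  unfold gaussMajorant
  apply mul_le_mul_of_nonneg_right _ (gauss_pos z).le
  calc (1 + ‖z‖) ^ k ≤ (1 + ‖z‖) ^ 3 :=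
        pow_le_pow_right₀ (by linarith [norm_nonneg z]) hk
    _ ≤ (Real.exp (2 * Real.pi * ‖z‖ + Real.pi)) ^ 3 :=
        pow_le_pow_left₀ (by positivity) (one_add_norm_le_exp z) 3
    _ = _ := by rw [← Real.exp_nat_mul]; norm_num

lemma abs_exp_sub_one_le (a : ℝ) : |Real.exp a - 1| ≤ |a| * Real.exp |a| := by
  have := Complex.norm_exp_sub_sum_le_norm_mul_exp (a : ℂ) 1
  simp only [Finset.sum_range_one, pow_zero, Nat.factorial_zero, Nat.cast_one, div_one, pow_one,
    Complex.norm_real, Real.norm_eq_abs] at this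
  rw [← Complex.ofReal_exp] at this
  have h2 : ((Real.exp a : ℂ) - 1) = ((Real.exp a - 1 : ℝ) : ℂ) := by push_cast; ring
  rwa [h2, Complex.norm_real] at this

lemma abs_exp_sub_one_sub_le (a : ℝ) : |Real.exp a - 1 - a| ≤ a ^ 2 * Real.exp |a| := by
  have := Complex.norm_exp_sub_sum_le_norm_mul_exp (a : ℂ) 2
  simp only [Finset.sum_range_succ, Finset.sum_range_zero, pow_zero, Nat.factorial_zero,
    Nat.cast_one, div_one, pow_one, zero_add, Nat.factorial_one,
    Complex.norm_real, Real.norm_eq_abs, sq_abs] at this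
  rw [← Complex.ofReal_exp] at this
  have h2 : ((Real.exp a : ℂ) - (1 + a)) = ((Real.exp a - 1 - a : ℝ) : ℂ) := by push_cast; ring
  rwa [h2, Complex.norm_real] at this

/-- Expanding the square turns a translation into a factor `exp a`, so differences of Gaussians
reduce to bounds on `exp a - 1` and `exp a - 1 - a`. -/
lemma gauss_sub (z p : V) : gauss (z - p) =
    Real.exp (2 * Real.pi * inner ℝ z p - Real.pi * ‖p‖ ^ 2) * gauss z := by
  unfold gauss
  rw [← Real.exp_add, norm_sub_sq_real]
  congr 1
  ring

lemma abs_gauss_exponent_le (z : V) {p : V} (hp : ‖p‖ ≤ 1) :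
    |2 * Real.pi * inner ℝ z p - Real.pi * ‖p‖ ^ 2| ≤ ‖p‖ * (2 * Real.pi * ‖z‖ + Real.pi) := by
  have h1 := abs_real_inner_le_norm z p
  have hpi := Real.pi_pos
  have h2 : ‖p‖ ^ 2 ≤ ‖p‖ := by nlinarith [norm_nonneg p]
  calc _ ≤ |2 * Real.pi * inner ℝ z p| + |Real.pi * ‖p‖ ^ 2| := abs_sub _ _
    _ = 2 * Real.pi * |inner ℝ z p| + Real.pi * ‖p‖ ^ 2 := by
        rw [abs_mul, abs_of_pos (by positivity : 0 < 2 * Real.pi), abs_of_nonneg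
          (by positivity : 0 ≤ Real.pi * ‖p‖ ^ 2)]
    _ ≤ 2 * Real.pi * (‖z‖ * ‖p‖) + Real.pi * ‖p‖ := by gcongr
    _ = _ := by ring

lemma abs_gauss_sub_sub_le (z : V) {p : V} (hp : ‖p‖ ≤ 1) :
    |gauss (z - p) - gauss z| ≤ ‖p‖ * gaussMajorant z := by
  set a := 2 * Real.pi * inner ℝ z p - Real.pi * ‖p‖ ^ 2 with ha
  set B := 2 * Real.pi * ‖z‖ + Real.pi with hB
  have hpi := Real.pi_pos
  have hB0 : 0 ≤ B := by positivity
  have h1 : |a| ≤ ‖p‖ * B := abs_gauss_exponent_le z hp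
  have h2 : |a| ≤ B := h1.trans (mul_le_of_le_one_left hB0 hp)
  have h3 : B ≤ Real.exp B := by linarith [Real.add_one_le_exp B]
  have : gauss (z - p) - gauss z = (Real.exp a - 1) * gauss z := by rw [gauss_sub]; ring
  rw [this, abs_mul, abs_of_pos (gauss_pos z), gaussMajorant, ← mul_assoc]
  apply mul_le_mul_of_nonneg_right _ (gauss_pos z).le
  calc |Real.exp a - 1| ≤ |a| * Real.exp |a| := abs_exp_sub_one_le a
    _ ≤ (‖p‖ * B) * Real.exp B := by gcongr
    _ ≤ (‖p‖ * Real.exp B) * Real.exp B := by gcongr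
    _ = ‖p‖ * Real.exp (2 * B) := by rw [two_mul B, Real.exp_add B B]; ring
    _ ≤ _ := by gcongr; norm_num

/-- The subtracted linear term is `a` without its `-π|p|²`, so `exp a - 1 - a` controls the rest.
With `B = 2π|z| + π`, two factors `exp B` come from the remainder and one from the weight `1 + |z|`,
which will pay for increments of Hölder functions; this is the `3` in `gaussMajorant`. -/
lemma abs_gauss_taylor_le (z : V) {p : V} (hp : ‖p‖ ≤ 1) :
    |gauss (z - p) - gauss z - 2 * Real.pi * inner ℝ z p * gauss z| * (1 + ‖z‖) ≤
      3 * ‖p‖ ^ 2 * gaussMajorant z := by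
  set a := 2 * Real.pi * inner ℝ z p - Real.pi * ‖p‖ ^ 2 with ha
  set B := 2 * Real.pi * ‖z‖ + Real.pi with hB
  have hpi := Real.pi_pos
  have hB0 : 0 ≤ B := by positivity
  have h1 : |a| ≤ ‖p‖ * B := abs_gauss_exponent_le z hp
  have h2 : |a| ≤ B := h1.trans (mul_le_of_le_one_left hB0 hp)
  have h3 : B ^ 2 ≤ 2 * Real.exp B := by linarith [Real.quadratic_le_exp_of_nonneg hB0]
  have h4 : Real.pi ≤ Real.exp (2 * B) := by
    have : Real.pi ≤ B := by rw [hB]; linarith [show 0 ≤ 2 * Real.pi * ‖z‖ by positivity]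
    linarith [Real.add_one_le_exp (2 * B)]
  have h5 : 1 + ‖z‖ ≤ Real.exp B := one_add_norm_le_exp z
  have : gauss (z - p) - gauss z - 2 * Real.pi * inner ℝ z p * gauss z =
      ((Real.exp a - 1 - a) - Real.pi * ‖p‖ ^ 2) * gauss z := by rw [gauss_sub]; ring
  rw [this, abs_mul, abs_of_pos (gauss_pos z), gaussMajorant, mul_right_comm, ← mul_assoc]
  apply mul_le_mul_of_nonneg_right _ (gauss_pos z).le
  have h6 : |(Real.exp a - 1 - a) - Real.pi * ‖p‖ ^ 2| ≤ 3 * ‖p‖ ^ 2 * Real.exp (2 * B) := by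
    calc _ ≤ |Real.exp a - 1 - a| + |Real.pi * ‖p‖ ^ 2| := abs_sub _ _
      _ ≤ a ^ 2 * Real.exp |a| + Real.pi * ‖p‖ ^ 2 := by
        rw [abs_of_nonneg (by positivity : 0 ≤ Real.pi * ‖p‖ ^ 2)]
        gcongr
        exact abs_exp_sub_one_sub_le a
      _ ≤ (‖p‖ * B) ^ 2 * Real.exp B + Real.exp (2 * B) * ‖p‖ ^ 2 := by
        rw [← sq_abs a]; gcongr
      _ = ‖p‖ ^ 2 * (B ^ 2 * Real.exp B + Real.exp (2 * B)) := by ring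
      _ ≤ ‖p‖ ^ 2 * ((2 * Real.exp B) * Real.exp B + Real.exp (2 * B)) := by gcongr
      _ = _ := by rw [two_mul B, Real.exp_add B B]; ring
  calc _ ≤ (3 * ‖p‖ ^ 2 * Real.exp (2 * B)) * Real.exp B := by gcongr
    _ = _ := by rw [mul_assoc, ← Real.exp_add]; congr 2; ring

/-- The triangle inequality alone: this covers `|p| ≥ 1` and gives integrability for every `p`. -/
lemma abs_gauss_taylor_le_add (z p : V) :
    |gauss (z - p) - gauss z - 2 * Real.pi * inner ℝ z p * gauss z| * (1 + ‖z‖) ≤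
      gauss (z - p) * (1 + ‖z‖) + (1 + 2 * Real.pi * ‖p‖) * gaussMajorant z := by
  have hpi := Real.pi_pos
  have hg := gauss_pos z
  have hg' := gauss_pos (z - p)
  have h2 := abs_real_inner_le_norm z p
  have h4 := one_add_norm_pow_mul_gauss_le z (k := 2) (by norm_num)
  calc _ ≤ (gauss (z - p) + gauss z + 2 * Real.pi * (‖z‖ * ‖p‖) * gauss z) * (1 + ‖z‖) := by
        gcongr
        refine (abs_sub _ _).trans (add_le_add ((abs_sub _ _).trans ?_) ?_)
        · rw [abs_of_pos hg, abs_of_pos hg']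
        · rw [abs_mul, abs_mul, abs_of_pos hg, abs_of_pos (by positivity : 0 < 2 * Real.pi)]
          gcongr
    _ ≤ gauss (z - p) * (1 + ‖z‖) + (1 + 2 * Real.pi * ‖p‖) * ((1 + ‖z‖) ^ 2 * gauss z) := by
        have : 0 ≤ 2 * Real.pi * ‖p‖ * gauss z * (1 + ‖z‖) := by positivity
        have : 0 ≤ ‖z‖ * gauss z * (1 + ‖z‖) := by positivity
        nlinarith
    _ ≤ _ := by gcongr

variable [FiniteDimensional ℝ V] [MeasurableSpace V] [BorelSpace V]

lemma integrable_gaussMajorant : Integrable (gaussMajorant : V → ℝ) := by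
  have hpi := Real.pi_pos
  have h0 : Integrable fun z : V => Real.exp (-(Real.pi / 2) * ‖z‖ ^ 2) := by
    have := GaussianFourier.integrable_cexp_neg_mul_sq_norm_add (V := V)
      (b := ((Real.pi / 2 : ℝ) : ℂ)) (by simpa using by positivity) 0 0
    refine this.norm.congr (Filter.Eventually.of_forall fun z => ?_)
    simp only [zero_mul, add_zero, Complex.norm_exp]
    congr 1
    norm_cast
  -- `21π = 3π + 18π`: the comparison of exponents is `(π/2)(|z| - 6)² ≥ 0`.
  refine (h0.const_mul (Real.exp (21 * Real.pi))).mono' (by fun_prop)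
    (Filter.Eventually.of_forall fun z => ?_)
  rw [Real.norm_of_nonneg (gaussMajorant_pos z).le, gaussMajorant, gauss, ← Real.exp_add,
    ← Real.exp_add]
  apply Real.exp_le_exp.2
  nlinarith [mul_nonneg hpi.le (sq_nonneg (‖z‖ - 6))]

lemma integrable_gauss : Integrable (gauss : V → ℝ) :=
  integrable_gaussMajorant.mono' (by fun_prop) (Filter.Eventually.of_forall fun z => by
    rw [Real.norm_of_nonneg (gauss_pos z).le]; exact gauss_le_majorant z)

lemma integral_gauss : ∫ z : V, gauss z = 1 := by
  unfold gauss
  rw [GaussianFourier.integral_rexp_neg_mul_sq_norm Real.pi_pos, div_self Real.pi_ne_zero,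
    Real.one_rpow]

lemma integrable_one_add_norm_mul_gauss : Integrable fun z : V => (1 + ‖z‖) * gauss z :=
  integrable_gaussMajorant.mono' (by fun_prop) (Filter.Eventually.of_forall fun z => by
    have := gauss_pos z
    rw [Real.norm_of_nonneg (by positivity)]
    simpa using one_add_norm_pow_mul_gauss_le z (k := 1) (by norm_num))

lemma integrable_gauss_sub (p : V) : Integrable fun z : V => gauss (z - p) :=
  integrable_gauss.comp_sub_right p

lemma integrable_gauss_sub_mul (p : V) : Integrable fun z : V => gauss (z - p) * (1 + ‖z‖) := by
  have h : Integrable fun z : V => gauss z * (1 + ‖z + p‖) := by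
    refine (integrable_one_add_norm_mul_gauss.const_mul (1 + ‖p‖)).mono' (by fun_prop)
      (Filter.Eventually.of_forall fun z => ?_)
    have := gauss_pos z
    rw [Real.norm_of_nonneg (by positivity), mul_comm, ← mul_assoc]
    gcongr
    nlinarith [norm_add_le z p, mul_nonneg (norm_nonneg z) (norm_nonneg p)]
  simpa using h.comp_sub_right p

lemma integrable_gauss_taylor (p : V) : Integrable fun z : V =>
    |gauss (z - p) - gauss z - 2 * Real.pi * inner ℝ z p * gauss z| * (1 + ‖z‖) := by
  have hpi := Real.pi_pos
  have h1 := (integrable_gauss_sub_mul p).add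
    ((integrable_gaussMajorant (V := V)).const_mul (1 + 2 * Real.pi * ‖p‖))
  refine h1.mono' (by fun_prop) (Filter.Eventually.of_forall fun z => ?_)
  rw [Real.norm_of_nonneg (by positivity)]
  exact abs_gauss_taylor_le_add z p

/-- The natural bound is a multiple of `min |p| 1`. It is relaxed to `|p|^(1/2)` because `p = h / t`
below, and `t^(-1/2)` is integrable over `0 < t ≤ 1` while `t⁻¹` is not. -/
lemma integral_abs_gauss_sub_sub_le (p : V) :
    ∫ z : V, |gauss (z - p) - gauss z| ≤
      2 * (∫ z : V, gaussMajorant z) * ‖p‖ ^ (1 / 2 : ℝ) := by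
  have hI : 1 ≤ ∫ z : V, gaussMajorant z := by
    rw [← integral_gauss (V := V)]
    exact integral_mono integrable_gauss integrable_gaussMajorant gauss_le_majorant
  have hint := ((integrable_gauss_sub p).sub integrable_gauss).abs
  rcases le_total ‖p‖ 1 with hp | hp
  · calc _ ≤ ∫ z : V, ‖p‖ * gaussMajorant z :=
          integral_mono hint (integrable_gaussMajorant.const_mul _)
            fun z => abs_gauss_sub_sub_le z hp
      _ = (∫ z : V, gaussMajorant z) * ‖p‖ := by rw [integral_const_mul, mul_comm]
      _ ≤ (2 * ∫ z : V, gaussMajorant z) * ‖p‖ ^ (1 / 2 : ℝ) := by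
          gcongr
          · linarith
          · exact Real.self_le_rpow_of_le_one (norm_nonneg p) hp (by norm_num)
  · calc _ ≤ ∫ z : V, (gauss (z - p) + gauss z) :=
          integral_mono hint ((integrable_gauss_sub p).add integrable_gauss) fun z => by
            refine (abs_sub _ _).trans ?_
            rw [abs_of_pos (gauss_pos _), abs_of_pos (gauss_pos _)]
      _ = 2 * 1 * 1 := by
          rw [integral_add (integrable_gauss_sub p) integrable_gauss,
            integral_sub_right_eq_self (fun z => gauss z), integral_gauss]
          norm_num
      _ ≤ _ := by
          gcongr
          exact Real.one_le_rpow hp (by norm_num)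

/-- The natural bound is of order `|p|²` for small and `|p|` for large `p`, hence any power between.
With `p = h / t` and a gain `t^(1/2)` from Hölder continuity, integrability in `t` requires a power
below `3/2`; differentiability requires one above `1`. The choice is `5/4`. -/
lemma integral_gauss_taylor_le (p : V) :
    ∫ z : V, |gauss (z - p) - gauss z - 2 * Real.pi * inner ℝ z p * gauss z| * (1 + ‖z‖) ≤
      12 * (∫ z : V, gaussMajorant z) * ‖p‖ ^ (5 / 4 : ℝ) := by
  have hpi := Real.pi_pos
  have hI : 0 ≤ ∫ z : V, gaussMajorant z := integral_nonneg fun z => (gaussMajorant_pos z).le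
  rcases le_total ‖p‖ 1 with hp | hp
  · calc _ ≤ ∫ z : V, 3 * ‖p‖ ^ 2 * gaussMajorant z :=
          integral_mono (integrable_gauss_taylor p) (integrable_gaussMajorant.const_mul _)
            fun z => abs_gauss_taylor_le z hp
      _ = 3 * (∫ z : V, gaussMajorant z) * ‖p‖ ^ (2 : ℝ) := by
          rw [integral_const_mul, Real.rpow_two]; ring
      _ ≤ (12 * ∫ z : V, gaussMajorant z) * ‖p‖ ^ (5 / 4 : ℝ) := by
          gcongr ?_ * ?_
          · linarith
          · exact Real.rpow_le_rpow_of_exponent_ge' (norm_nonneg p) hp (by norm_num) (by norm_num)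
  · have hshift : ∫ z : V, gauss (z - p) * (1 + ‖z‖) ≤ (1 + ‖p‖) * ∫ z : V, gaussMajorant z := by
      have h := integral_sub_right_eq_self (μ := (volume : Measure V))
        (fun z : V => gauss z * (1 + ‖z + p‖)) p
      simp only [sub_add_cancel] at h
      have hi : Integrable fun z : V => gauss z * (1 + ‖z + p‖) := by
        simpa using (integrable_gauss_sub_mul p).comp_add_right p
      rw [h, ← integral_const_mul]
      refine integral_mono hi (integrable_gaussMajorant.const_mul _) fun z => ?_
      have := gauss_pos z
      calc gauss z * (1 + ‖z + p‖) ≤ gauss z * ((1 + ‖p‖) * (1 + ‖z‖)) := by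
            gcongr
            nlinarith [norm_add_le z p, mul_nonneg (norm_nonneg z) (norm_nonneg p)]
        _ = (1 + ‖p‖) * ((1 + ‖z‖) ^ 1 * gauss z) := by ring
        _ ≤ _ := by
          gcongr
          exact one_add_norm_pow_mul_gauss_le z (by norm_num)
    calc _ ≤ ∫ z : V, (gauss (z - p) * (1 + ‖z‖) + (1 + 2 * Real.pi * ‖p‖) * gaussMajorant z) := by
          refine integral_mono (integrable_gauss_taylor p)
            ((integrable_gauss_sub_mul p).add (integrable_gaussMajorant.const_mul _)) fun z => ?_
          exact abs_gauss_taylor_le_add z p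
      _ ≤ (1 + ‖p‖) * (∫ z : V, gaussMajorant z) +
            (1 + 2 * Real.pi * ‖p‖) * ∫ z : V, gaussMajorant z := by
          rw [integral_add (integrable_gauss_sub_mul p) (integrable_gaussMajorant.const_mul _),
            integral_const_mul]
          gcongr
      _ = (2 + (1 + 2 * Real.pi) * ‖p‖) * ∫ z : V, gaussMajorant z := by ring
      _ ≤ (12 * ‖p‖) * ∫ z : V, gaussMajorant z := by
          gcongr
          nlinarith [Real.pi_lt_four]
      _ = 12 * (∫ z : V, gaussMajorant z) * ‖p‖ ^ (1 : ℝ) := by rw [Real.rpow_one]; ring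
      _ ≤ _ := by
          gcongr
          · norm_num

end Gaussian

/-! ### Gaussian averages, their means over all scales, and the regularity gained. -/

section Heat

set_option linter.unusedSectionVars false

variable {V : Type*} [NormedAddCommGroup V] [InnerProductSpace ℝ V]
  [FiniteDimensional ℝ V] [MeasurableSpace V] [BorelSpace V]

/-- The Gaussian average of `f` around `x` at scale `t`, i.e. the heat semigroup at time
`t² / (4 π)`. -/
def heat {F : Type*} [NormedAddCommGroup F] [NormedSpace ℝ F] (t : ℝ) (f : V → F) (x : V) : F :=
  ∫ z : V, gauss z • f (x + t • z)

/-- The gradient of `heat t f`, for `t > 0`. -/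
def heatGrad (t : ℝ) (f : V → ℝ) (x : V) : V :=
  ∫ z : V, (2 * Real.pi / t * gauss z * (f (x + t • z) - f x)) • z

/-- The mean of `heat t f` over the scales `0 < t ≤ 1`, a local version of the Riesz potential
of order one. -/
def rieszMean (f : V → ℝ) (x : V) : ℝ := ∫ t in Set.Ioc (0 : ℝ) 1, heat t f x

/-- The mean of `heatGrad t f` over the scales `0 < t ≤ 1`. -/
def rieszMeanGrad (f : V → ℝ) (x : V) : V := ∫ t in Set.Ioc (0 : ℝ) 1, heatGrad t f x

variable {f : V → ℝ} {M K t : ℝ}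

/-- The translation is moved from `f` to the kernel, so no smoothness of `f` is needed. -/
lemma heat_add (ht : 0 < t) (x h : V) :
    heat t f (x + h) = ∫ z : V, gauss (z - t⁻¹ • h) * f (x + t • z) := by
  rw [← integral_add_right_eq_self _ (t⁻¹ • h)]
  unfold heat
  congr 1 with z
  rw [add_sub_cancel_right, smul_add, smul_inv_smul₀ ht.ne', smul_eq_mul]
  congr 2
  abel

lemma integrable_mul_comp (hf : Measurable f) (hM : ∀ x, |f x| ≤ M) {w : V → ℝ}
    (hw : Integrable w) (x : V) (t : ℝ) : Integrable fun z : V => w z * f (x + t • z) :=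
  hw.mul_bdd (c := M) (by fun_prop : Measurable fun z : V => f (x + t • z)).aestronglyMeasurable
    (Filter.Eventually.of_forall fun z => hM _)

lemma abs_heat_le (hM : ∀ x, |f x| ≤ M) (t : ℝ) (x : V) : |heat t f x| ≤ M := by
  calc |heat t f x| ≤ ∫ z : V, gauss z * M := by
        rw [← Real.norm_eq_abs]
        refine norm_integral_le_of_norm_le ((integrable_gauss (V := V)).mul_const M)
          (Filter.Eventually.of_forall fun z => ?_)
        rw [norm_smul, Real.norm_of_nonneg (gauss_pos z).le]
        exact mul_le_mul_of_nonneg_left (hM _) (gauss_pos z).le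
    _ = M := by rw [integral_mul_const, integral_gauss, one_mul]

lemma abs_heat_add_sub_le (hf : Measurable f) (hM : ∀ x, |f x| ≤ M) (ht : 0 < t) (x h : V) :
    |heat t f (x + h) - heat t f x| ≤
      2 * (∫ z : V, gaussMajorant z) * M * ‖t⁻¹ • h‖ ^ (1 / 2 : ℝ) := by
  have hM0 : 0 ≤ M := (abs_nonneg _).trans (hM 0)
  have h1 : heat t f (x + h) - heat t f x =
      ∫ z : V, (gauss (z - t⁻¹ • h) - gauss z) * f (x + t • z) := by
    rw [heat_add ht]
    unfold heat
    simp only [smul_eq_mul]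
    rw [← integral_sub (integrable_mul_comp hf hM (integrable_gauss_sub _) x t)
      (integrable_mul_comp hf hM integrable_gauss x t)]
    simp only [sub_mul]
  have hint : Integrable fun z : V => |gauss (z - t⁻¹ • h) - gauss z| :=
    ((integrable_gauss_sub _).sub integrable_gauss).abs
  rw [h1]
  calc |∫ z : V, (gauss (z - t⁻¹ • h) - gauss z) * f (x + t • z)|
      ≤ ∫ z : V, |gauss (z - t⁻¹ • h) - gauss z| * M := by
        rw [← Real.norm_eq_abs]
        refine norm_integral_le_of_norm_le (hint.mul_const M)
          (Filter.Eventually.of_forall fun z => ?_)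
        rw [norm_mul, Real.norm_eq_abs, Real.norm_eq_abs]
        gcongr
        exact hM _
    _ = (∫ z : V, |gauss (z - t⁻¹ • h) - gauss z|) * M := integral_mul_const _ _
    _ ≤ (2 * (∫ z : V, gaussMajorant z) * ‖t⁻¹ • h‖ ^ (1 / 2 : ℝ)) * M := by
        gcongr
        exact integral_abs_gauss_sub_sub_le _
    _ = _ := by ring

lemma norm_heatGrad_integrand_le (ht : 0 < t) {x : V}
    (hK : ∀ z, |f (x + t • z) - f x| ≤ K * (1 + ‖z‖)) (z : V) :
    ‖(2 * Real.pi / t * gauss z * (f (x + t • z) - f x)) • z‖ ≤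
      2 * Real.pi / t * K * gaussMajorant z := by
  have hpi := Real.pi_pos
  have hg := gauss_pos z
  have hK0 : 0 ≤ K := by simpa using (abs_nonneg _).trans (hK 0)
  rw [norm_smul, norm_mul, Real.norm_of_nonneg (by positivity), Real.norm_eq_abs]
  calc _ ≤ 2 * Real.pi / t * gauss z * (K * (1 + ‖z‖)) * (1 + ‖z‖) := by
        gcongr
        · exact hK z
        · linarith
    _ = 2 * Real.pi / t * K * ((1 + ‖z‖) ^ 2 * gauss z) := by ring
    _ ≤ _ := by
        gcongr
        exact one_add_norm_pow_mul_gauss_le z (by norm_num)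

lemma integrable_heatGrad_integrand (hf : Measurable f) (ht : 0 < t) {x : V}
    (hK : ∀ z, |f (x + t • z) - f x| ≤ K * (1 + ‖z‖)) :
    Integrable fun z : V => (2 * Real.pi / t * gauss z * (f (x + t • z) - f x)) • z := by
  refine (integrable_gaussMajorant.const_mul (2 * Real.pi / t * K)).mono' ?_
    (Filter.Eventually.of_forall fun z => norm_heatGrad_integrand_le ht hK z)
  exact (by fun_prop : Measurable fun z : V =>
    (2 * Real.pi / t * gauss z * (f (x + t • z) - f x)) • z).aestronglyMeasurable

lemma norm_heatGrad_le (ht : 0 < t) {x : V}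
    (hK : ∀ z, |f (x + t • z) - f x| ≤ K * (1 + ‖z‖)) :
    ‖heatGrad t f x‖ ≤ 2 * Real.pi / t * K * ∫ z : V, gaussMajorant z := by
  rw [← integral_const_mul]
  exact norm_integral_le_of_norm_le (integrable_gaussMajorant.const_mul _)
    (Filter.Eventually.of_forall fun z => norm_heatGrad_integrand_le ht hK z)

lemma abs_heat_taylor_le (hf : Measurable f) (hM : ∀ x, |f x| ≤ M) (ht : 0 < t) {x : V}
    (hK : ∀ z, |f (x + t • z) - f x| ≤ K * (1 + ‖z‖)) (h : V) :
    |heat t f (x + h) - heat t f x - inner ℝ (heatGrad t f x) h| ≤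
      12 * (∫ z : V, gaussMajorant z) * K * ‖t⁻¹ • h‖ ^ (5 / 4 : ℝ) := by
  have hK0 : 0 ≤ K := by simpa using (abs_nonneg _).trans (hK 0)
  set p : V := t⁻¹ • h with hp
  have i1 := integrable_mul_comp hf hM (integrable_gauss_sub p) x t
  have i2 := integrable_mul_comp hf hM (integrable_gauss (V := V)) x t
  have i3 := (integrable_heatGrad_integrand hf ht hK).const_inner (𝕜 := ℝ) h
  have i4 := (integrable_gauss_sub p).mul_const (f x)
  have i5 := (integrable_gauss (V := V)).mul_const (f x)
  have h1 : heat t f (x + h) - heat t f x - inner ℝ (heatGrad t f x) h =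
      ∫ z : V, (gauss (z - p) - gauss z - 2 * Real.pi * inner ℝ z p * gauss z) *
        (f (x + t • z) - f x) := by
    rw [heat_add ht, real_inner_comm, heatGrad,
      ← integral_inner (integrable_heatGrad_integrand hf ht hK)]
    unfold heat
    simp only [smul_eq_mul]
    -- Translation preserves the mass of the Gaussian, so the constant `f x` may be subtracted from
    -- `f`. Only increments of `f` remain, which is where its Hölder continuity enters.
    have h0 : ∫ z : V, (gauss (z - p) * f x - gauss z * f x) = 0 := by
      rw [integral_sub i4 i5, integral_mul_const, integral_mul_const,
        integral_sub_right_eq_self (fun z => gauss z), sub_self]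
    have e1 := integral_sub i1 i2
    have e2 := integral_sub (i1.sub i2) i3
    have e3 := integral_sub ((i1.sub i2).sub i3) (i4.sub i5)
    simp only [Pi.sub_apply] at e1 e2 e3
    rw [← hp, ← e1, ← e2, ← sub_zero (∫ _ : V, _), ← h0, ← e3]
    congr 1 with z
    rw [inner_smul_right, hp, inner_smul_right, real_inner_comm]
    field_simp
    ring
  rw [h1]
  calc |∫ z : V, (gauss (z - p) - gauss z - 2 * Real.pi * inner ℝ z p * gauss z) *
        (f (x + t • z) - f x)|
      ≤ ∫ z : V, |gauss (z - p) - gauss z - 2 * Real.pi * inner ℝ z p * gauss z| *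
          (1 + ‖z‖) * K := by
        rw [← Real.norm_eq_abs]
        refine norm_integral_le_of_norm_le ((integrable_gauss_taylor p).mul_const K)
          (Filter.Eventually.of_forall fun z => ?_)
        rw [norm_mul, Real.norm_eq_abs, Real.norm_eq_abs]
        exact (mul_le_mul_of_nonneg_left (hK z) (abs_nonneg _)).trans (le_of_eq (by ring))
    _ = (∫ z : V, |gauss (z - p) - gauss z - 2 * Real.pi * inner ℝ z p * gauss z| *
          (1 + ‖z‖)) * K := integral_mul_const _ _
    _ ≤ (12 * (∫ z : V, gaussMajorant z) * ‖p‖ ^ (5 / 4 : ℝ)) * K := by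
        gcongr
        exact integral_gauss_taylor_le _
    _ = _ := by ring

lemma measurable_heat (hf : Measurable f) (x : V) : StronglyMeasurable fun t => heat t f x := by
  unfold heat
  refine StronglyMeasurable.integral_prod_right
    (f := fun (t : ℝ) (z : V) => gauss z • f (x + t • z)) ?_
  exact (by fun_prop : Measurable fun q : ℝ × V => gauss q.2 • f (x + q.1 • q.2)).stronglyMeasurable

lemma measurable_heatGrad (hf : Measurable f) (x : V) :
    StronglyMeasurable fun t => heatGrad t f x := by
  unfold heatGrad
  refine StronglyMeasurable.integral_prod_right
    (f := fun (t : ℝ) (z : V) => (2 * Real.pi / t * gauss z * (f (x + t • z) - f x)) • z) ?_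
  exact (by fun_prop : Measurable fun q : ℝ × V => (2 * Real.pi / q.1 * gauss q.2 *
    (f (x + q.1 • q.2) - f x)) • q.2).stronglyMeasurable

lemma integrableOn_heat (hf : Measurable f) (hM : ∀ x, |f x| ≤ M) (x : V) :
    IntegrableOn (fun t => heat t f x) (Set.Ioc 0 1) := by
  refine Integrable.mono' (g := fun _ => M) (by simp)
    (measurable_heat hf x).aestronglyMeasurable
    (Filter.Eventually.of_forall fun t => abs_heat_le hM t x)

lemma integrableOn_rpow_Ioc {s : ℝ} (hs : -1 < s) :
    IntegrableOn (fun t : ℝ => t ^ s) (Set.Ioc 0 1) :=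
  (intervalIntegrable_iff_integrableOn_Ioc_of_le zero_le_one).1
    (intervalIntegral.intervalIntegrable_rpow' hs)

lemma setIntegral_rpow_Ioc {s : ℝ} (hs : -1 < s) :
    ∫ t in Set.Ioc (0 : ℝ) 1, t ^ s = 1 / (s + 1) := by
  rw [← intervalIntegral.integral_of_le zero_le_one, integral_rpow (Or.inl hs), Real.one_rpow,
    Real.zero_rpow (by linarith), sub_zero]

/-- Averages over all scales of bounded functions are Hölder continuous of exponent `1 / 2`. -/
lemma abs_rieszMean_add_sub_le (hf : Measurable f) (hM : ∀ x, |f x| ≤ M) (x h : V) :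
    |rieszMean f (x + h) - rieszMean f x| ≤
      4 * (∫ z : V, gaussMajorant z) * M * ‖h‖ ^ (1 / 2 : ℝ) := by
  unfold rieszMean
  rw [← integral_sub (integrableOn_heat hf hM _) (integrableOn_heat hf hM _)]
  calc _ ≤ ∫ t in Set.Ioc (0 : ℝ) 1,
        2 * (∫ z : V, gaussMajorant z) * M * ‖h‖ ^ (1 / 2 : ℝ) * t ^ (-(1 / 2) : ℝ) := by
        rw [← Real.norm_eq_abs]
        refine norm_integral_le_of_norm_le
          ((integrableOn_rpow_Ioc (s := -(1 / 2)) (by norm_num)).const_mul _) ?_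
        filter_upwards [ae_restrict_mem measurableSet_Ioc] with t ht
        refine (abs_heat_add_sub_le hf hM ht.1 x h).trans (le_of_eq ?_)
        rw [norm_smul, norm_inv, Real.norm_of_nonneg ht.1.le,
          Real.mul_rpow (inv_nonneg.2 ht.1.le) (norm_nonneg h), Real.inv_rpow ht.1.le,
          Real.rpow_neg ht.1.le]
        ring
    _ = _ := by
        rw [integral_const_mul, setIntegral_rpow_Ioc (by norm_num)]
        ring

/-- The first-order Taylor expansion of averages over all scales of functions that are Hölder
continuous of exponent `1 / 2`. -/
lemma abs_rieszMean_taylor_le (hf : Measurable f) (hM : ∀ x, |f x| ≤ M) {x : V}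
    (hK : ∀ t ∈ Set.Ioc (0 : ℝ) 1, ∀ z,
      |f (x + t • z) - f x| ≤ K * t ^ (1 / 2 : ℝ) * (1 + ‖z‖)) (h : V) :
    |rieszMean f (x + h) - rieszMean f x - inner ℝ (rieszMeanGrad f x) h| ≤
      48 * (∫ z : V, gaussMajorant z) * K * ‖h‖ ^ (5 / 4 : ℝ) := by
  have hgrad : IntegrableOn (fun t => heatGrad t f x) (Set.Ioc 0 1) := by
    refine Integrable.mono' ((integrableOn_rpow_Ioc (s := -(1 / 2)) (by norm_num)).const_mul
      (2 * Real.pi * K * ∫ z : V, gaussMajorant z))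
      (measurable_heatGrad hf x).aestronglyMeasurable ?_
    filter_upwards [ae_restrict_mem measurableSet_Ioc] with t ht
    refine (norm_heatGrad_le ht.1 (hK t ht)).trans (le_of_eq ?_)
    have : t ^ (-(1 / 2) : ℝ) = t ^ (1 / 2 : ℝ) / t := by
      rw [← Real.rpow_sub_one ht.1.ne']; norm_num
    rw [this]
    ring
  have i1 := integrableOn_heat hf hM (x + h)
  have i2 := integrableOn_heat hf hM x
  have i3 := Integrable.const_inner (𝕜 := ℝ) h hgrad
  unfold rieszMean rieszMeanGrad
  have e := integral_sub (i1.sub i2) i3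
  simp only [Pi.sub_apply] at e
  rw [real_inner_comm, ← integral_inner hgrad, ← integral_sub i1 i2, ← e]
  calc _ ≤ ∫ t in Set.Ioc (0 : ℝ) 1,
        12 * (∫ z : V, gaussMajorant z) * K * ‖h‖ ^ (5 / 4 : ℝ) * t ^ (-(3 / 4) : ℝ) := by
        rw [← Real.norm_eq_abs]
        refine norm_integral_le_of_norm_le
          ((integrableOn_rpow_Ioc (s := -(3 / 4)) (by norm_num)).const_mul _) ?_
        filter_upwards [ae_restrict_mem measurableSet_Ioc] with t ht
        have := abs_heat_taylor_le hf hM ht.1 (hK t ht) h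
        rw [real_inner_comm] at this
        refine this.trans (le_of_eq ?_)
        have e : t ^ (-(3 / 4) : ℝ) = t ^ (1 / 2 : ℝ) * (t ^ (5 / 4 : ℝ))⁻¹ := by
          rw [← Real.rpow_neg ht.1.le, ← Real.rpow_add ht.1]; norm_num
        rw [norm_smul, norm_inv, Real.norm_of_nonneg ht.1.le,
          Real.mul_rpow (inv_nonneg.2 ht.1.le) (norm_nonneg h), Real.inv_rpow ht.1.le, e]
        ring
    _ = _ := by
        rw [integral_const_mul, setIntegral_rpow_Ioc (by norm_num)]
        ring

/-- A function with a uniform first-order Taylor expansion with remainder of order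
`|h| ^ (5 / 4)` is continuously differentiable. -/
lemma contDiff_one_of_taylor {u : V → ℝ} {G : V → V} {C : ℝ}
    (hC : ∀ x h, |u (x + h) - u x - inner ℝ (G x) h| ≤ C * ‖h‖ ^ (5 / 4 : ℝ)) :
    ContDiff ℝ 1 u := by
  -- On the zero space `C` may be negative; elsewhere a nonzero vector shows `0 ≤ C`.
  rcases subsingleton_or_nontrivial V with hV | hV
  · rw [show u = fun _ => u 0 from funext fun x => by rw [Subsingleton.elim x 0]]
    exact contDiff_const
  have hC0 : 0 ≤ C := by
    obtain ⟨v, hv⟩ := exists_ne (0 : V)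
    have := (abs_nonneg _).trans (hC 0 v)
    have h2 : 0 < ‖v‖ ^ (5 / 4 : ℝ) := Real.rpow_pos_of_pos (norm_pos_iff.2 hv) _
    exact nonneg_of_mul_nonneg_left this h2
  rw [contDiff_one_iff_hasFDerivAt]
  refine ⟨fun x => innerSL ℝ (G x), (innerSL ℝ).continuous.comp ?_, fun x => ?_⟩
  · have hG : ∀ x h, ‖G (x + h) - G x‖ ≤ 6 * C * ‖h‖ ^ (1 / 4 : ℝ) := by
      intro x h
      set D := G (x + h) - G x with hD
      rcases eq_or_ne D 0 with h0 | h0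
      · rw [h0, norm_zero]; positivity
      rcases eq_or_ne h 0 with hh | hh
      · simp [hD, hh] at h0
      have hDp : 0 < ‖D‖ := norm_pos_iff.2 h0
      have hhp : 0 < ‖h‖ := norm_pos_iff.2 hh
      -- An increment of length `|h|` along `D`. The expansions at `x + h` for `k`, and at `x` for
      -- `h + k` and for `h`, combine to `⟨D, k⟩ = |h| |D|`; their errors add up to `1 + 4 + 1 = 6`
      -- multiples of `C |h|^(5/4)`.
      set k : V := (‖h‖ / ‖D‖) • D with hk
      have hkn : ‖k‖ = ‖h‖ := by
        rw [hk, norm_smul, Real.norm_of_nonneg (by positivity), div_mul_cancel₀ _ hDp.ne']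
      have hin : inner ℝ D k = ‖h‖ * ‖D‖ := by
        rw [hk, inner_smul_right, real_inner_self_eq_norm_sq]; field_simp
      have a1 := hC (x + h) k
      have a2 := hC x (h + k)
      have a3 := hC x h
      have hp : ‖h + k‖ ^ (5 / 4 : ℝ) ≤ 4 * ‖h‖ ^ (5 / 4 : ℝ) := by
        calc ‖h + k‖ ^ (5 / 4 : ℝ) ≤ (2 * ‖h‖) ^ (5 / 4 : ℝ) := by
              gcongr
              linarith [norm_add_le h k]
          _ = 2 ^ (5 / 4 : ℝ) * ‖h‖ ^ (5 / 4 : ℝ) := Real.mul_rpow (by norm_num) hhp.le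
          _ ≤ 2 ^ (2 : ℝ) * ‖h‖ ^ (5 / 4 : ℝ) := by
              gcongr <;> norm_num
          _ = _ := by norm_num
      have hp' := mul_le_mul_of_nonneg_left hp hC0
      rw [hkn] at a1
      rw [← add_assoc, inner_add_right] at a2
      have key : ‖h‖ * ‖D‖ ≤ 6 * C * ‖h‖ ^ (5 / 4 : ℝ) := by
        rw [← hin, hD, inner_sub_left]
        rw [abs_le] at a1 a2 a3
        linarith [a1.1, a1.2, a2.1, a2.2, a3.1, a3.2]
      have e : ‖h‖ ^ (5 / 4 : ℝ) = ‖h‖ * ‖h‖ ^ (1 / 4 : ℝ) := by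
        rw [← Real.rpow_one_add' hhp.le (by norm_num)]; norm_num
      rw [e] at key
      refine le_of_mul_le_mul_left ?_ hhp
      linarith
    rw [continuous_iff_continuousAt]
    intro x
    rw [ContinuousAt, tendsto_iff_norm_sub_tendsto_zero]
    refine squeeze_zero (fun _ => norm_nonneg _)
      (g := fun y => 6 * C * ‖y - x‖ ^ (1 / 4 : ℝ)) (fun y => ?_) ?_
    · simpa using hG x (y - x)
    · have : Continuous fun y : V => 6 * C * ‖y - x‖ ^ (1 / 4 : ℝ) :=
        continuous_const.mul ((continuous_id.sub continuous_const).norm.rpow_const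
          fun _ => Or.inr (by norm_num))
      have h := this.tendsto x
      simpa using h
  · rw [hasFDerivAt_iff_isLittleO_nhds_zero]
    have hlim : Filter.Tendsto (fun h : V => C * ‖h‖ ^ (1 / 4 : ℝ)) (nhds 0) (nhds 0) := by
      have : Continuous fun y : V => C * ‖y‖ ^ (1 / 4 : ℝ) :=
        continuous_const.mul (continuous_norm.rpow_const fun _ => Or.inr (by norm_num))
      simpa using this.tendsto 0
    rw [Asymptotics.isLittleO_iff]
    intro c hc
    filter_upwards [hlim.eventually (gt_mem_nhds hc)] with h hh
    have := hC x h
    rw [Real.norm_eq_abs, innerSL_apply_apply]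
    refine this.trans ?_
    rcases eq_or_ne h 0 with h0 | h0
    · simp [h0]
    have e : ‖h‖ ^ (5 / 4 : ℝ) = ‖h‖ ^ (1 / 4 : ℝ) * ‖h‖ := by
      rw [← Real.rpow_add_one (norm_ne_zero_iff.2 h0)]; norm_num
    rw [e, ← mul_assoc]
    gcongr

end Heat

/-! ### The covering map and Fourier coefficients on the torus. -/

section Torus

open UnitAddTorus

variable {n : ℕ} {L : ℝ}

instance : Measure.IsAddHaarMeasure (torusMeasure n) :=
  inferInstanceAs (Measure.IsAddHaarMeasure (Measure.pi fun _ => AddCircle.haarAddCircle))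

instance : IsProbabilityMeasure (torusMeasure n) :=
  inferInstanceAs (IsProbabilityMeasure (Measure.pi fun _ => AddCircle.haarAddCircle))

lemma cover_add (x y : EuclideanSpace ℝ (Fin n)) : cover L (x + y) = cover L x + cover L y := by
  ext i
  simp [cover, add_div]

lemma cover_sub (x y : EuclideanSpace ℝ (Fin n)) : cover L (x - y) = cover L x - cover L y := by
  ext i
  simp [cover, sub_div]

@[fun_prop]
lemma continuous_cover : Continuous (cover L : EuclideanSpace ℝ (Fin n) → _) := by
  unfold cover
  refine continuous_pi fun i => (AddCircle.continuous_mk' 1).comp ?_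
  fun_prop

@[fun_prop]
lemma measurable_cover : Measurable (cover L : EuclideanSpace ℝ (Fin n) → _) :=
  continuous_cover.measurable

lemma cover_surjective (hL : L ≠ 0) (θ : UnitAddTorus (Fin n)) :
    ∃ x : EuclideanSpace ℝ (Fin n), cover L x = θ := by
  choose y hy using fun i => QuotientAddGroup.mk_surjective (θ i)
  refine ⟨WithLp.toLp 2 fun i => L * y i, funext fun i => ?_⟩
  simp only [cover]
  rw [mul_div_cancel_left₀ _ hL]
  exact hy i

lemma norm_cover_le (hL : 0 < L) (x : EuclideanSpace ℝ (Fin n)) : ‖cover L x‖ ≤ ‖x‖ / L := by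
  refine (pi_norm_le_iff_of_nonneg (by positivity)).2 fun i => ?_
  have h : ‖((x i / L : ℝ) : UnitAddCircle)‖ ≤ |x i / L| := QuotientAddGroup.norm_mk_le_norm
  refine h.trans ?_
  rw [abs_div, abs_of_pos hL]
  gcongr
  exact PiLp.norm_apply_le x i

/-- The wave vector `k / L` of the `k`-th character of the torus of side `L`. -/
def freq (L : ℝ) (k : Fin n → ℤ) : EuclideanSpace ℝ (Fin n) := WithLp.toLp 2 fun i => (k i : ℝ) / L

lemma norm_freq_sq (k : Fin n → ℤ) : ‖freq L k‖ ^ 2 = (∑ i, (k i : ℝ) ^ 2) / L ^ 2 := by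
  rw [EuclideanSpace.norm_sq_eq, Finset.sum_div]
  simp [freq, div_pow]

lemma symbol_eq (hL : 0 < L) (k : Fin n → ℤ) : symbol L k = 2 * Real.pi * ‖freq L k‖ := by
  rw [← Real.sqrt_sq (norm_nonneg (freq L k)), norm_freq_sq, Real.sqrt_div' _ (by positivity),
    Real.sqrt_sq hL.le, symbol]
  ring

lemma mFourier_cover (k : Fin n → ℤ) (x : EuclideanSpace ℝ (Fin n)) :
    mFourier k (cover L x) =
      Complex.exp ((2 * Real.pi * inner ℝ (freq L k) x : ℝ) * Complex.I) := by
  simp only [mFourier, ContinuousMap.coe_mk, cover, fourier_coe_apply, PiLp.inner_apply, freq,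
    ← Complex.exp_sum]
  congr 1
  push_cast
  rw [Finset.mul_sum, Finset.sum_mul]
  refine Finset.sum_congr rfl fun i _ => ?_
  simp only [RCLike.inner_apply, conj_trivial]
  push_cast
  ring

lemma mFourier_apply_add (k : Fin n → ℤ) (a b : UnitAddTorus (Fin n)) :
    mFourier k (a + b) = mFourier k a * mFourier k b := by
  simp only [mFourier, ContinuousMap.coe_mk, Pi.add_apply, fourier_apply, smul_add,
    AddCircle.toCircle_add, Circle.coe_mul, Finset.prod_mul_distrib]

lemma norm_mFourier_apply (k : Fin n → ℤ) (a : UnitAddTorus (Fin n)) : ‖mFourier k a‖ = 1 := by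
  rw [mFourier, ContinuousMap.coe_mk, norm_prod]
  exact Finset.prod_eq_one fun i _ => Circle.norm_coe _

lemma mFourierCoeff_eq (f : UnitAddTorus (Fin n) → ℂ) (k : Fin n → ℤ) :
    mFourierCoeff f k = ∫ θ, mFourier (-k) θ * f θ ∂torusMeasure n := rfl

lemma mFourierCoeff_congr_ae {f g : UnitAddTorus (Fin n) → ℂ} (h : f =ᵐ[torusMeasure n] g)
    (k : Fin n → ℤ) : mFourierCoeff f k = mFourierCoeff g k := by
  rw [mFourierCoeff_eq, mFourierCoeff_eq]
  exact integral_congr_ae (h.mono fun θ hθ => by simp only [hθ])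

lemma integrable_mFourier_mul {f : UnitAddTorus (Fin n) → ℂ} (hf : Integrable f (torusMeasure n))
    (k : Fin n → ℤ) : Integrable (fun θ => mFourier k θ * f θ) (torusMeasure n) :=
  hf.bdd_mul (c := 1) (mFourier k).continuous.aestronglyMeasurable
    (Filter.Eventually.of_forall fun θ => (norm_mFourier_apply k θ).le)

lemma norm_mFourierCoeff_le (f : UnitAddTorus (Fin n) → ℂ) (k : Fin n → ℤ) :
    ‖mFourierCoeff f k‖ ≤ ∫ θ, ‖f θ‖ ∂torusMeasure n := by
  rw [mFourierCoeff_eq]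
  refine (norm_integral_le_integral_norm _).trans (le_of_eq ?_)
  simp only [norm_mul, norm_mFourier_apply, one_mul]

lemma mFourierCoeff_add {f g : UnitAddTorus (Fin n) → ℂ} (hf : Integrable f (torusMeasure n))
    (hg : Integrable g (torusMeasure n)) (k : Fin n → ℤ) :
    mFourierCoeff (fun θ => f θ + g θ) k = mFourierCoeff f k + mFourierCoeff g k := by
  simp only [mFourierCoeff_eq, mul_add]
  exact integral_add (integrable_mFourier_mul hf _) (integrable_mFourier_mul hg _)

lemma mFourierCoeff_const_mul (c : ℂ) (f : UnitAddTorus (Fin n) → ℂ) (k : Fin n → ℤ) :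
    mFourierCoeff (fun θ => c * f θ) k = c * mFourierCoeff f k := by
  simp only [mFourierCoeff_eq, mul_left_comm _ c, integral_const_mul]

lemma mFourierCoeff_comp_add (f : UnitAddTorus (Fin n) → ℂ) (a : UnitAddTorus (Fin n))
    (k : Fin n → ℤ) :
    mFourierCoeff (fun θ => f (θ + a)) k = mFourier k a * mFourierCoeff f k := by
  rw [mFourierCoeff_eq, mFourierCoeff_eq, ← integral_add_right_eq_self _ a,
    ← integral_const_mul]
  rw [← integral_add_right_eq_self (fun θ => mFourier k a * (mFourier (-k) θ * f θ)) a]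
  rw [integral_add_right_eq_self (fun θ => mFourier (-k) θ * f (θ + a)) a]
  congr 1 with θ
  have h : mFourier k a * mFourier (-k) a = 1 := by
    rw [← mFourier_add, add_neg_cancel, mFourier_zero, ContinuousMap.one_apply]
  rw [mFourier_apply_add]
  linear_combination -(mFourier (-k) θ * f (θ + a)) * h

/-- Fourier coefficients of a superposition of functions. -/
lemma mFourierCoeff_integral {Y : Type*} [MeasurableSpace Y] {ν : Measure Y} [SFinite ν]
    {H : UnitAddTorus (Fin n) → Y → ℂ}
    (hH : Integrable (Function.uncurry H) ((torusMeasure n).prod ν)) (k : Fin n → ℤ) :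
    mFourierCoeff (fun θ => ∫ y, H θ y ∂ν) k = ∫ y, mFourierCoeff (fun θ => H θ y) k ∂ν := by
  simp only [mFourierCoeff_eq, ← integral_const_mul]
  refine integral_integral_swap ?_
  refine hH.bdd_mul (c := 1) (f := fun q : UnitAddTorus (Fin n) × Y => mFourier (-k) q.1)
    ?_ (Filter.Eventually.of_forall fun q => (norm_mFourier_apply _ _).le)
  exact ((mFourier (-k)).continuous.measurable.comp measurable_fst).aestronglyMeasurable

/-- A square-integrable function on the torus is determined by its Fourier coefficients. -/
lemma ae_eq_of_mFourierCoeff_eq {f g : UnitAddTorus (Fin n) → ℂ}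
    (hf : MemLp f 2 (torusMeasure n)) (hg : MemLp g 2 (torusMeasure n))
    (h : ∀ k, mFourierCoeff f k = mFourierCoeff g k) : f =ᵐ[torusMeasure n] g := by
  have key : hf.toLp f = hg.toLp g := by
    apply (mFourierBasis (d := Fin n)).repr.injective
    ext k
    refine (mFourierBasis_repr (hf.toLp f) k).trans
      (Eq.trans ?_ (mFourierBasis_repr (hg.toLp g) k).symm)
    exact (mFourierCoeff_congr_ae hf.coeFn_toLp k).trans
      ((h k).trans (mFourierCoeff_congr_ae hg.coeFn_toLp k).symm)
  exact (MemLp.toLp_eq_toLp_iff hf hg).1 key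

lemma mFourierCoeff_mFourier (j k : Fin n → ℤ) :
    mFourierCoeff (fun θ => mFourier j θ) k = if k = j then 1 else 0 := by
  have h := orthonormal_iff_ite.1 (orthonormal_mFourier (d := Fin n)) k j
  rw [← h, mFourierCoeff_eq]
  simp only [ContinuousMap.inner_toLp, ← mFourier_neg, mul_comm]
  rfl

end Torus

/-! ### Fourier multipliers of the averages, and the approximate inverse of the half-Laplacian. -/

section Multipliers

open UnitAddTorus

variable {n : ℕ} {L : ℝ}

/-- The Gaussian average at scale `t` on the torus. -/
def heatTorus {F : Type*} [NormedAddCommGroup F] [NormedSpace ℝ F] (L t : ℝ)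
    (f : UnitAddTorus (Fin n) → F) (θ : UnitAddTorus (Fin n)) : F :=
  ∫ z : EuclideanSpace ℝ (Fin n), gauss z • f (θ + cover L (t • z))

/-- The mean of the Gaussian averages over the scales `0 < t ≤ 1`, on the torus. -/
def rieszTorus (L : ℝ) (f : UnitAddTorus (Fin n) → ℝ) (θ : UnitAddTorus (Fin n)) : ℝ :=
  ∫ t in Set.Ioc (0 : ℝ) 1, heatTorus L t f θ

/-- The Fourier multiplier of `rieszTorus`, as a function of the length of the wave vector. -/
def rieszMult (κ : ℝ) : ℝ := ∫ t in Set.Ioc (0 : ℝ) 1, Real.exp (-Real.pi * t ^ 2 * κ ^ 2)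

lemma lift_heatTorus (t : ℝ) (f : UnitAddTorus (Fin n) → ℝ) :
    lift L (heatTorus L t f) = heat t (lift L f) := by
  ext x
  simp only [lift, heatTorus, heat, cover_add]

lemma lift_rieszTorus (f : UnitAddTorus (Fin n) → ℝ) :
    lift L (rieszTorus L f) = rieszMean (lift L f) := by
  ext x
  simp only [lift, rieszTorus, rieszMean, heatTorus, heat, cover_add]

/-- The Gaussian `exp(-π|z|²)` is its own Fourier transform, evaluated here at `t k / L`. -/
lemma integral_gauss_mul_mFourier (t : ℝ) (k : Fin n → ℤ) :
    ∫ z : EuclideanSpace ℝ (Fin n), (gauss z : ℂ) * mFourier k (cover L (t • z)) =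
      Real.exp (-Real.pi * t ^ 2 * ‖freq L k‖ ^ 2) := by
  have h := GaussianFourier.integral_cexp_neg_mul_sq_norm_add (b := (Real.pi : ℂ))
    (by simpa using Real.pi_pos) (2 * Real.pi * t * Complex.I) (freq L k)
  have hpi : (Real.pi : ℂ) ≠ 0 := by exact_mod_cast Real.pi_ne_zero
  rw [div_self hpi, Complex.one_cpow, one_mul] at h
  calc _ = ∫ z : EuclideanSpace ℝ (Fin n), Complex.exp (-(Real.pi : ℂ) * ‖z‖ ^ 2 +
        2 * Real.pi * t * Complex.I * (inner ℝ (freq L k) z : ℝ)) := by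
        congr 1 with z
        rw [mFourier_cover, gauss, Complex.ofReal_exp, ← Complex.exp_add, inner_smul_right]
        congr 1
        push_cast
        ring
    _ = _ := by
        rw [h, Complex.ofReal_exp]
        congr 1
        push_cast
        field_simp
        rw [Complex.I_sq]
        ring

lemma measurable_heatTorus_integrand {f : UnitAddTorus (Fin n) → ℂ} (hf : Measurable f) (t : ℝ) :
    Measurable fun q : UnitAddTorus (Fin n) × EuclideanSpace ℝ (Fin n) =>
      gauss q.2 • f (q.1 + cover L (t • q.2)) := by
  fun_prop

lemma mFourierCoeff_heatTorus {f : UnitAddTorus (Fin n) → ℂ} (hf : Measurable f) {M : ℝ}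
    (hM : ∀ θ, ‖f θ‖ ≤ M) (t : ℝ) (k : Fin n → ℤ) :
    mFourierCoeff (heatTorus L t f) k =
      Real.exp (-Real.pi * t ^ 2 * ‖freq L k‖ ^ 2) * mFourierCoeff f k := by
  unfold heatTorus
  rw [mFourierCoeff_integral (H := fun θ (z : EuclideanSpace ℝ (Fin n)) =>
    gauss z • f (θ + cover L (t • z)))]
  · simp only [Complex.real_smul, mFourierCoeff_const_mul, mFourierCoeff_comp_add, ← mul_assoc]
    rw [integral_mul_const, integral_gauss_mul_mFourier]
  · have h1 : Integrable (fun q : UnitAddTorus (Fin n) × EuclideanSpace ℝ (Fin n) =>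
        (1 : ℝ) * (gauss q.2 * M)) ((torusMeasure n).prod volume) :=
      (integrable_const (1 : ℝ)).mul_prod (integrable_gauss.mul_const M)
    refine h1.mono' (measurable_heatTorus_integrand hf t).aestronglyMeasurable
      (Filter.Eventually.of_forall fun q => ?_)
    have := gauss_pos q.2
    simp only [Function.uncurry, norm_smul, one_mul, Real.norm_of_nonneg this.le]
    gcongr
    exact hM _

lemma norm_heatTorus_le {F : Type*} [NormedAddCommGroup F] [NormedSpace ℝ F]
    {f : UnitAddTorus (Fin n) → F} {M : ℝ} (hM : ∀ θ, ‖f θ‖ ≤ M) (t : ℝ)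
    (θ : UnitAddTorus (Fin n)) : ‖heatTorus L t f θ‖ ≤ M := by
  calc ‖heatTorus L t f θ‖ ≤ ∫ z : EuclideanSpace ℝ (Fin n), gauss z * M := by
        refine norm_integral_le_of_norm_le (integrable_gauss.mul_const M)
          (Filter.Eventually.of_forall fun z => ?_)
        rw [norm_smul, Real.norm_of_nonneg (gauss_pos z).le]
        exact mul_le_mul_of_nonneg_left (hM _) (gauss_pos z).le
    _ = M := by rw [integral_mul_const, integral_gauss, one_mul]

lemma ofReal_heatTorus (t : ℝ) (f : UnitAddTorus (Fin n) → ℝ) (θ : UnitAddTorus (Fin n)) :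
    ((heatTorus L t f θ : ℝ) : ℂ) = heatTorus L t (fun θ => (f θ : ℂ)) θ := by
  unfold heatTorus
  rw [← integral_complex_ofReal]
  simp only [smul_eq_mul, Complex.ofReal_mul, Complex.real_smul]

lemma mFourierCoeff_rieszTorus {f : UnitAddTorus (Fin n) → ℝ} (hf : Measurable f) {M : ℝ}
    (hM : ∀ θ, |f θ| ≤ M) (k : Fin n → ℤ) :
    coeff (rieszTorus L f) k = rieszMult ‖freq L k‖ * coeff f k := by
  have hfc : Measurable fun θ => (f θ : ℂ) := Complex.measurable_ofReal.comp hf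
  have hMc : ∀ θ, ‖(f θ : ℂ)‖ ≤ M := fun θ => by simpa using hM θ
  unfold coeff
  simp only [rieszTorus, ← integral_complex_ofReal, ofReal_heatTorus]
  rw [mFourierCoeff_integral (H := fun θ t => heatTorus L t (fun θ => (f θ : ℂ)) θ)]
  · simp only [mFourierCoeff_heatTorus hfc hMc]
    rw [integral_mul_const, integral_complex_ofReal, rieszMult]
  · refine Integrable.mono' (g := fun _ => M) (integrable_const M) ?_
      (Filter.Eventually.of_forall fun q => norm_heatTorus_le hMc q.2 q.1)
    unfold heatTorus
    refine StronglyMeasurable.aestronglyMeasurable ?_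
    refine StronglyMeasurable.integral_prod_right (f := fun (q : UnitAddTorus (Fin n) × ℝ)
      (z : EuclideanSpace ℝ (Fin n)) => gauss z • (f (q.1 + cover L (q.2 • z)) : ℂ)) ?_
    exact (by fun_prop : Measurable fun p : (UnitAddTorus (Fin n) × ℝ) × EuclideanSpace ℝ (Fin n) =>
      gauss p.2 • (f (p.1.1 + cover L (p.1.2 • p.2)) : ℂ)).stronglyMeasurable

/-- For `κ > 0` the integral over all `t > 0` is exactly `1 / (2κ)`, so the error is the tail over
`t > 1`. There `t² ≥ 1` allows half of the exponent to be taken out of the integral. -/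
lemma abs_one_sub_rieszMult_le {κ : ℝ} (hκ : 0 ≤ κ) :
    |1 - 2 * κ * rieszMult κ| ≤ 2 * Real.exp (-(Real.pi / 2) * κ ^ 2) := by
  rcases hκ.eq_or_lt with rfl | hκ
  · simp
  have hpi := Real.pi_pos
  have hint : ∀ b : ℝ, 0 < b → Integrable fun t : ℝ => Real.exp (-b * t ^ 2) :=
    fun b hb => integrable_exp_neg_mul_sq hb
  have hb : 0 < Real.pi * κ ^ 2 := by positivity
  have hb' : 0 < Real.pi * κ ^ 2 / 2 := by positivity
  have hm : rieszMult κ = ∫ t in Set.Ioc (0 : ℝ) 1, Real.exp (-(Real.pi * κ ^ 2) * t ^ 2) := by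
    unfold rieszMult
    congr 1 with t
    congr 1
    ring
  have hsplit : rieszMult κ + ∫ t in Set.Ioi (1 : ℝ), Real.exp (-(Real.pi * κ ^ 2) * t ^ 2) =
      1 / (2 * κ) := by
    rw [hm, ← setIntegral_union Set.Ioc_disjoint_Ioi_same measurableSet_Ioi
      (hint _ hb).integrableOn (hint _ hb).integrableOn, Set.Ioc_union_Ioi_eq_Ioi zero_le_one,
      integral_gaussian_Ioi, show Real.pi / (Real.pi * κ ^ 2) = (1 / κ) ^ 2 by field_simp,
      Real.sqrt_sq (by positivity)]
    field_simp
  have htail : ∫ t in Set.Ioi (1 : ℝ), Real.exp (-(Real.pi * κ ^ 2) * t ^ 2) ≤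
      Real.exp (-(Real.pi / 2) * κ ^ 2) / κ := by
    calc _ ≤ ∫ t in Set.Ioi (1 : ℝ),
          Real.exp (-(Real.pi / 2) * κ ^ 2) * Real.exp (-(Real.pi * κ ^ 2 / 2) * t ^ 2) := by
          refine setIntegral_mono_on (hint _ hb).integrableOn
            ((hint _ hb').integrableOn.const_mul _) measurableSet_Ioi fun t ht => ?_
          rw [← Real.exp_add]
          apply Real.exp_le_exp.2
          have : 1 ≤ t ^ 2 := one_le_pow₀ (le_of_lt ht)
          nlinarith
      _ = Real.exp (-(Real.pi / 2) * κ ^ 2) *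
          ∫ t in Set.Ioi (1 : ℝ), Real.exp (-(Real.pi * κ ^ 2 / 2) * t ^ 2) :=
          integral_const_mul _ _
      _ ≤ Real.exp (-(Real.pi / 2) * κ ^ 2) *
          ∫ t in Set.Ioi (0 : ℝ), Real.exp (-(Real.pi * κ ^ 2 / 2) * t ^ 2) := by
          refine mul_le_mul_of_nonneg_left ?_ (Real.exp_pos _).le
          exact setIntegral_mono_set (hint _ hb').integrableOn
            (Filter.Eventually.of_forall fun t => (Real.exp_pos _).le)
            (Set.Ioi_subset_Ioi zero_le_one).eventuallyLE
      _ ≤ Real.exp (-(Real.pi / 2) * κ ^ 2) * (1 / κ) := by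
          gcongr
          rw [integral_gaussian_Ioi, show Real.pi / (Real.pi * κ ^ 2 / 2) = 2 * (1 / κ) ^ 2 by
            field_simp, Real.sqrt_mul (by norm_num), Real.sqrt_sq (by positivity)]
          have : Real.sqrt 2 ≤ 2 := Real.sqrt_le_left (by norm_num) |>.2 (by norm_num)
          have h1 : 0 < 1 / κ := by positivity
          nlinarith
      _ = _ := by ring
  have htail0 : 0 ≤ ∫ t in Set.Ioi (1 : ℝ), Real.exp (-(Real.pi * κ ^ 2) * t ^ 2) :=
    integral_nonneg fun t => (Real.exp_pos _).le
  have e : 1 - 2 * κ * rieszMult κ =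
      2 * κ * ∫ t in Set.Ioi (1 : ℝ), Real.exp (-(Real.pi * κ ^ 2) * t ^ 2) := by
    have := congrArg (fun s => 2 * κ * s) hsplit
    simp only [mul_add] at this
    rw [mul_one_div_cancel (by positivity)] at this
    linarith
  rw [e, abs_of_nonneg (by positivity)]
  calc _ ≤ 2 * κ * (Real.exp (-(Real.pi / 2) * κ ^ 2) / κ) := by gcongr
    _ = _ := by field_simp

/-- The summand is a product over coordinates, and each finite set of frequencies lies in a box, so
the sums are bounded by a power of a one-dimensional theta series. -/
lemma summable_exp_neg_freq (hL : 0 < L) {a : ℝ} (ha : 0 < a) :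
    Summable fun k : Fin n → ℤ => Real.exp (-a * ‖freq L k‖ ^ 2) := by
  set w : ℤ → ℝ := fun m => Real.exp (-(a / L ^ 2) * (m : ℝ) ^ 2) with hw
  have hc : 0 < a / L ^ 2 := by positivity
  have hws : Summable w := by
    have h1 : Summable fun m : ℕ => Real.exp (-(a / L ^ 2) * (m : ℝ) ^ 2) := by
      refine Summable.of_nonneg_of_le (fun m => (Real.exp_pos _).le) (fun m => ?_)
        (Real.summable_exp_nat_mul_of_ge (c := -(a / L ^ 2)) (f := fun m => (m : ℝ) ^ 2)
          (by linarith) (fun m => ?_))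
      · exact le_rfl
      · exact_mod_cast Nat.le_self_pow two_ne_zero m
    refine Summable.of_nat_of_neg ?_ ?_ <;> simpa [hw] using h1
  have hprod : ∀ k : Fin n → ℤ, Real.exp (-a * ‖freq L k‖ ^ 2) = ∏ i, w (k i) := by
    intro k
    rw [hw, ← Real.exp_sum, norm_freq_sq, ← Finset.mul_sum]
    congr 1
    ring
  simp only [hprod]
  refine summable_of_sum_le (c := ∏ _i : Fin n, ∑' m, w m)
    (fun k => Finset.prod_nonneg fun i _ => (Real.exp_pos _).le) fun S => ?_
  classical
  calc ∑ k ∈ S, ∏ i, w (k i)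
      ≤ ∑ k ∈ Fintype.piFinset fun i => S.image fun k => k i, ∏ i, w (k i) := by
        refine Finset.sum_le_sum_of_subset_of_nonneg (fun k hk => ?_) fun k _ _ =>
          Finset.prod_nonneg fun i _ => (Real.exp_pos _).le
        exact Fintype.mem_piFinset.2 fun i => Finset.mem_image_of_mem _ hk
    _ = ∏ i, ∑ m ∈ S.image fun k => k i, w m := (Finset.prod_univ_sum _ _).symm
    _ ≤ _ := Finset.prod_le_prod (fun i _ => Finset.sum_nonneg fun m _ => (Real.exp_pos _).le)
        fun i _ => hws.sum_le_tsum _ fun m _ => (Real.exp_pos _).le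

/-- An absolutely summable family is the family of Fourier coefficients of a continuous
function. -/
lemma exists_continuous_mFourierCoeff_eq {c : (Fin n → ℤ) → ℂ} (hc : Summable fun k => ‖c k‖) :
    ∃ ρ : C(UnitAddTorus (Fin n), ℂ), ∀ k, mFourierCoeff ρ k = c k := by
  have hs : Summable fun j => c j • mFourier (d := Fin n) j :=
    .of_norm (by simpa only [norm_smul, mFourier_norm, mul_one] using hc)
  refine ⟨∑' j, c j • mFourier j, fun k => ?_⟩
  have hρ : ∀ θ, (∑' j, c j • mFourier (d := Fin n) j) θ = ∑' j, c j * mFourier j θ := by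
    intro θ
    simpa using (ContinuousMap.tsum_apply hs θ).symm
  have hF : ∀ j, Integrable (fun θ => mFourier (-k) θ * (c j * mFourier (d := Fin n) j θ))
      (torusMeasure n) := fun j => by
    refine integrable_mFourier_mul (Integrable.const_mul ?_ _) _
    exact (mFourier j).continuous.integrable_of_hasCompactSupport
      (HasCompactSupport.of_compactSpace _)
  rw [mFourierCoeff_eq]
  simp only [hρ, ← tsum_mul_left]
  rw [← integral_tsum_of_summable_integral_norm hF]
  · have : ∀ j, ∫ θ, mFourier (-k) θ * (c j * mFourier (d := Fin n) j θ) ∂torusMeasure n =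
        if j = k then c k else 0 := by
      intro j
      rw [← mFourierCoeff_eq, mFourierCoeff_const_mul, mFourierCoeff_mFourier]
      by_cases h : j = k
      · simp [h]
      · simp [h, Ne.symm h]
    simp only [this, tsum_ite_eq]
  · simpa [norm_mFourier_apply] using hc

/-- The part of `g` that is not recovered from its half-Laplacian by `rieszTorus` is the Gaussian
average at scale `1 / 2` of a continuous function. -/
lemma exists_continuous_remainder (hL : 0 < L) (g : UnitAddTorus (Fin n) → ℝ) :
    ∃ ρ : C(UnitAddTorus (Fin n), ℂ), ∀ k,
      Real.exp (-Real.pi * (1 / 2) ^ 2 * ‖freq L k‖ ^ 2) * mFourierCoeff ρ k =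
        ((1 - 2 * ‖freq L k‖ * rieszMult ‖freq L k‖ : ℝ) : ℂ) * coeff g k := by
  have hpi := Real.pi_pos
  set A := ∫ θ, ‖(g θ : ℂ)‖ ∂torusMeasure n with hA
  -- Dividing by the multiplier `exp(-(π/4)|ξ|²)` of scale `1/2` uses up half of the decay
  -- `exp(-(π/2)|ξ|²)`; the other half makes the coefficients of `ρ` summable.
  have hc : Summable fun k : Fin n → ℤ =>
      ‖((Real.exp (Real.pi / 4 * ‖freq L k‖ ^ 2) *
        (1 - 2 * ‖freq L k‖ * rieszMult ‖freq L k‖) : ℝ) : ℂ) * coeff g k‖ := by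
    refine Summable.of_nonneg_of_le (fun _ => norm_nonneg _) (fun k => ?_)
      ((summable_exp_neg_freq (n := n) hL (a := Real.pi / 4) (by positivity)).mul_left (2 * A))
    rw [norm_mul, Complex.norm_real, norm_mul, Real.norm_of_nonneg (Real.exp_pos _).le,
      Real.norm_eq_abs]
    calc _ ≤ Real.exp (Real.pi / 4 * ‖freq L k‖ ^ 2) *
          (2 * Real.exp (-(Real.pi / 2) * ‖freq L k‖ ^ 2)) * A := by
          gcongr
          · exact abs_one_sub_rieszMult_le (norm_nonneg _)
          · exact norm_mFourierCoeff_le _ k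
      _ = 2 * A * (Real.exp (Real.pi / 4 * ‖freq L k‖ ^ 2) *
          Real.exp (-(Real.pi / 2) * ‖freq L k‖ ^ 2)) := by ring
      _ = _ := by rw [← Real.exp_add]; congr 2; ring
  obtain ⟨ρ, hρ⟩ := exists_continuous_mFourierCoeff_eq hc
  refine ⟨ρ, fun k => ?_⟩
  rw [hρ, ← mul_assoc, ← Complex.ofReal_mul, ← mul_assoc, ← Real.exp_add,
    show -Real.pi * (1 / 2) ^ 2 * ‖freq L k‖ ^ 2 + Real.pi / 4 * ‖freq L k‖ ^ 2 = 0 by ring,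
    Real.exp_zero, one_mul]

end Multipliers

/-! ### The singular integral: convergence, symbol, pointwise value. -/

section Singular

open UnitAddTorus

variable {n : ℕ} {L : ℝ}

/-- In polar coordinates the kernel becomes `r^(-2)`: the bound `B r^s` gives integrability at `0`
because `s > 1`, and the bound `A` gives it at infinity. -/
lemma integrable_min_rpow_div [NeZero n] {A B s : ℝ} (hA : 0 ≤ A) (hB : 0 ≤ B) (hs : 1 < s) :
    Integrable fun y : EuclideanSpace ℝ (Fin n) => min A (B * ‖y‖ ^ s) / ‖y‖ ^ (n + 1) := by
  have hn : 1 ≤ n := NeZero.one_le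
  have : Nontrivial (EuclideanSpace ℝ (Fin n)) :=
    Module.nontrivial_of_finrank_pos (R := ℝ) (by rw [finrank_euclideanSpace_fin]; omega)
  rw [integrable_fun_norm_addHaar volume (f := fun r : ℝ => min A (B * r ^ s) / r ^ (n + 1)),
    finrank_euclideanSpace_fin, ← Set.Ioc_union_Ioi_eq_Ioi (zero_le_one (α := ℝ))]
  have hmeas : ∀ S : Set ℝ, AEStronglyMeasurable
      (fun r : ℝ => r ^ (n - 1) • (min A (B * r ^ s) / r ^ (n + 1))) (volume.restrict S) :=
    fun S => (by fun_prop : Measurable fun r : ℝ =>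
      r ^ (n - 1) • (min A (B * r ^ s) / r ^ (n + 1))).aestronglyMeasurable
  have heq : ∀ r : ℝ, 0 < r →
      ‖r ^ (n - 1) • (min A (B * r ^ s) / r ^ (n + 1))‖ = min A (B * r ^ s) * r ^ (-2 : ℝ) := by
    intro r hr
    have h0 : 0 ≤ min A (B * r ^ s) := le_min hA (mul_nonneg hB (Real.rpow_nonneg hr.le _))
    rw [smul_eq_mul, Real.norm_of_nonneg (by positivity), Real.rpow_neg hr.le, Real.rpow_two]
    obtain ⟨m, rfl⟩ : ∃ m, n = m + 1 := ⟨n - 1, by omega⟩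
    rw [Nat.add_sub_cancel]
    field_simp
    ring
  refine IntegrableOn.union ?_ ?_
  · refine ((integrableOn_rpow_Ioc (s := s - 2) (by linarith)).const_mul B).mono' (hmeas _) ?_
    filter_upwards [ae_restrict_mem measurableSet_Ioc] with r hr
    rw [heq r hr.1, show s - 2 = s + (-2) by ring, Real.rpow_add hr.1, ← mul_assoc]
    exact mul_le_mul_of_nonneg_right (min_le_right _ _) (Real.rpow_nonneg hr.1.le _)
  · refine ((integrableOn_Ioi_rpow_of_lt (a := -2) (by norm_num)
      zero_lt_one).const_mul A).mono' (hmeas _) ?_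
    filter_upwards [ae_restrict_mem measurableSet_Ioi] with r hr
    have hr0 : (0 : ℝ) < r := zero_lt_one.trans hr
    rw [heq r hr0]
    exact mul_le_mul_of_nonneg_right (min_le_left _ _) (Real.rpow_nonneg hr0.le _)

/-- The value at `ξ` of the symbol of the singular integral, before normalisation. -/
def cosIntegral (ξ : EuclideanSpace ℝ (Fin n)) : ℝ :=
  ∫ y : EuclideanSpace ℝ (Fin n), (1 - Real.cos (inner ℝ ξ y)) / ‖y‖ ^ (n + 1)

lemma cosIntegral_smul {r : ℝ} (hr : 0 < r) (v : EuclideanSpace ℝ (Fin n)) :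
    cosIntegral (r • v) = r * cosIntegral v := by
  have h := Measure.integral_comp_smul (volume : Measure (EuclideanSpace ℝ (Fin n)))
    (fun y => (1 - Real.cos (inner ℝ v y)) / ‖y‖ ^ (n + 1)) r
  rw [finrank_euclideanSpace_fin, abs_of_pos (by positivity), smul_eq_mul] at h
  have h2 : ∀ y : EuclideanSpace ℝ (Fin n),
      (1 - Real.cos (inner ℝ v (r • y))) / ‖r • y‖ ^ (n + 1) =
        (r ^ (n + 1))⁻¹ * ((1 - Real.cos (inner ℝ (r • v) y)) / ‖y‖ ^ (n + 1)) := by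
    intro y
    rw [inner_smul_right, real_inner_smul_left, norm_smul, Real.norm_of_nonneg hr.le, mul_pow]
    field_simp
  simp only [h2] at h
  rw [integral_const_mul] at h
  unfold cosIntegral
  field_simp at h
  refine mul_right_cancel₀ (pow_ne_zero n hr.ne') (h.trans ?_)
  ring

/-- The reflection that exchanges `v` and `w` preserves Lebesgue measure and the norm. -/
lemma cosIntegral_eq_of_norm_eq {v w : EuclideanSpace ℝ (Fin n)} (h : ‖v‖ = ‖w‖) :
    cosIntegral v = cosIntegral w := by
  set R := Submodule.reflection (ℝ ∙ (v - w))ᗮ with hR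
  have hRv : R v = w := Submodule.reflection_sub h
  unfold cosIntegral
  rw [← R.measurePreserving.integral_comp R.toHomeomorph.measurableEmbedding
    (fun y => (1 - Real.cos (inner ℝ w y)) / ‖y‖ ^ (n + 1))]
  congr 1 with y
  rw [← hRv, R.inner_map_map, R.norm_map]

/-- Homogeneity of degree one and invariance under isometries leave only a multiple of `|ξ|`; the
factor is the value at the first unit vector, which defines `normConst`. -/
lemma cosIntegral_eq [NeZero n] (ξ : EuclideanSpace ℝ (Fin n)) :
    cosIntegral ξ = ‖ξ‖ * (normConst n)⁻¹ := by
  have hc : (normConst n)⁻¹ = cosIntegral (EuclideanSpace.single (0 : Fin n) (1 : ℝ)) := by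
    simp [normConst, cosIntegral, EuclideanSpace.inner_single_left]
  rcases eq_or_ne ξ 0 with rfl | hξ
  · simp [cosIntegral]
  rw [hc, ← cosIntegral_smul (norm_pos_iff.2 hξ)]
  refine cosIntegral_eq_of_norm_eq ?_
  simp [norm_smul]

lemma normConst_nonneg [NeZero n] : 0 ≤ normConst n :=
  inv_nonneg.2 (integral_nonneg fun y =>
    div_nonneg (by linarith [Real.cos_le_one (y 0)]) (by positivity))

lemma one_sub_cos_le_min {a r : ℝ} (har : |a| ≤ r) :
    1 - Real.cos a ≤ min 2 (1 * r ^ (2 : ℝ)) := by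
  refine le_min (by linarith [Real.neg_one_le_cos a]) ?_
  have h1 := Real.one_sub_sq_div_two_le_cos (x := a)
  have h2 : a ^ 2 ≤ r ^ 2 := by rw [← sq_abs a]; gcongr
  rw [Real.rpow_two]
  nlinarith [sq_nonneg r]

/-- Integrability has to be proved too: a divergent integral would be `0` by default, and so would
its inverse. -/
lemma normConst_pos [NeZero n] : 0 < normConst n := by
  refine inv_pos.2 ((integral_pos_iff_support_of_nonneg (fun y =>
    div_nonneg (by linarith [Real.cos_le_one (y 0)]) (by positivity)) ?_).2 ?_)
  · refine (integrable_min_rpow_div (n := n) (A := 2) (B := 1) (s := 2) (by norm_num) (by norm_num)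
      (by norm_num)).mono' ?_ (Filter.Eventually.of_forall fun y => ?_)
    · exact (by fun_prop : Measurable fun y : EuclideanSpace ℝ (Fin n) =>
        (1 - Real.cos (y 0)) / ‖y‖ ^ (n + 1)).aestronglyMeasurable
    · rw [Real.norm_of_nonneg (div_nonneg (by linarith [Real.cos_le_one (y 0)]) (by positivity))]
      gcongr
      exact one_sub_cos_le_min (PiLp.norm_apply_le y 0)
  · have hopen : IsOpen {y : EuclideanSpace ℝ (Fin n) | Real.cos (y 0) < 1} :=
      isOpen_lt (by fun_prop) continuous_const
    refine lt_of_lt_of_le (hopen.measure_pos volume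
      ⟨EuclideanSpace.single (0 : Fin n) Real.pi, by simp⟩) (measure_mono fun y hy => ?_)
    have hy' : Real.cos (y 0) < 1 := hy
    have h0 : y ≠ 0 := by
      rintro rfl
      simp at hy'
    exact div_ne_zero (by linarith) (pow_ne_zero _ (norm_ne_zero_iff.2 h0))

/-- The function on the torus that corresponds to the half-Laplacian of the lift of `u`. -/
def halfLaplacianTorus [NeZero n] (L : ℝ) (u : UnitAddTorus (Fin n) → ℝ)
    (θ : UnitAddTorus (Fin n)) : ℝ :=
  -(normConst n / 2) * ∫ y : EuclideanSpace ℝ (Fin n),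
    (u (θ + cover L y) + u (θ - cover L y) - 2 * u θ) / ‖y‖ ^ (n + 1)

lemma halfLaplacian_lift [NeZero n] (u : UnitAddTorus (Fin n) → ℝ)
    (x : EuclideanSpace ℝ (Fin n)) :
    halfLaplacian (lift L u) x = halfLaplacianTorus L u (cover L x) := by
  simp only [halfLaplacian, halfLaplacianTorus, diffKernel, lift, cover_add, cover_sub]

lemma mFourier_add_mFourier_neg (k : Fin n → ℤ) (y : EuclideanSpace ℝ (Fin n)) :
    mFourier k (cover L y) + mFourier k (-cover L y) - 2 =
      ((-2 * (1 - Real.cos (inner ℝ ((2 * Real.pi) • freq L k) y)) : ℝ) : ℂ) := by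
  have h : -cover L y = cover L (-y) := by
    have := cover_sub (L := L) 0 y
    rw [zero_sub] at this
    rw [this, show cover L (0 : EuclideanSpace ℝ (Fin n)) = 0 by ext i; simp [cover], zero_sub]
  rw [h, mFourier_cover, mFourier_cover, inner_neg_right, real_inner_smul_left]
  push_cast
  rw [Complex.cos]
  ring_nf

/-- The symmetric second differences of `u` are of order `|h| ^ (5 / 4)`. -/
def HasSmallSecondDiff (L C : ℝ) (u : UnitAddTorus (Fin n) → ℝ) : Prop :=
  ∀ (θ : UnitAddTorus (Fin n)) (y : EuclideanSpace ℝ (Fin n)),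
    |u (θ + cover L y) + u (θ - cover L y) - 2 * u θ| ≤ C * ‖y‖ ^ (5 / 4 : ℝ)

/-- A majorant independent of `θ`, integrable since `5/4 > 1`; it serves absolute convergence,
dominated convergence and Fubini. -/
lemma HasSmallSecondDiff.norm_kernel_le {C M : ℝ} {u : UnitAddTorus (Fin n) → ℝ}
    (hu : HasSmallSecondDiff L C u) (hM : ∀ θ, |u θ| ≤ M) (θ : UnitAddTorus (Fin n))
    (y : EuclideanSpace ℝ (Fin n)) :
    ‖(u (θ + cover L y) + u (θ - cover L y) - 2 * u θ) / ‖y‖ ^ (n + 1)‖ ≤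
      min (4 * M) (|C| * ‖y‖ ^ (5 / 4 : ℝ)) / ‖y‖ ^ (n + 1) := by
  rw [norm_div, norm_pow, norm_norm, Real.norm_eq_abs]
  gcongr
  refine le_min ?_ ((hu θ y).trans (by gcongr; exact le_abs_self C))
  have h1 := abs_le.1 (hM (θ + cover L y))
  have h2 := abs_le.1 (hM (θ - cover L y))
  have h3 := abs_le.1 (hM θ)
  rw [abs_le]
  constructor <;> linarith [h1.1, h1.2, h2.1, h2.2, h3.1, h3.2]

section

variable [NeZero n] {C M : ℝ} {u : UnitAddTorus (Fin n) → ℝ}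

lemma integrable_secondDiff_bound (C : ℝ) (hM : ∀ θ, |u θ| ≤ M) :
    Integrable fun y : EuclideanSpace ℝ (Fin n) =>
      min (4 * M) (|C| * ‖y‖ ^ (5 / 4 : ℝ)) / ‖y‖ ^ (n + 1) :=
  integrable_min_rpow_div (by linarith [(abs_nonneg _).trans (hM 0)]) (abs_nonneg C) (by norm_num)

lemma HasSmallSecondDiff.integrable_diffKernel (hu : HasSmallSecondDiff L C u) (hc : Continuous u)
    (hM : ∀ θ, |u θ| ≤ M) (x : EuclideanSpace ℝ (Fin n)) :
    Integrable (diffKernel (lift L u) x) := by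
  have hm := hc.measurable
  refine (integrable_secondDiff_bound C hM).mono' ?_ (Filter.Eventually.of_forall fun y => ?_)
  · unfold diffKernel lift
    exact (by fun_prop : Measurable fun y => (u (cover L (x + y)) + u (cover L (x - y)) -
      2 * u (cover L x)) / ‖y‖ ^ (n + 1)).aestronglyMeasurable
  · simp only [diffKernel, lift, cover_add, cover_sub]
    exact hu.norm_kernel_le hM _ y

lemma HasSmallSecondDiff.continuous_halfLaplacianTorus (hu : HasSmallSecondDiff L C u)
    (hc : Continuous u) (hM : ∀ θ, |u θ| ≤ M) : Continuous (halfLaplacianTorus L u) := by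
  have hm := hc.measurable
  unfold halfLaplacianTorus
  refine continuous_const.mul (continuous_of_dominated (fun θ => ?_)
    (fun θ => Filter.Eventually.of_forall fun y => hu.norm_kernel_le hM θ y)
    (integrable_secondDiff_bound C hM) (Filter.Eventually.of_forall fun y => ?_))
  · exact (by fun_prop : Measurable fun y : EuclideanSpace ℝ (Fin n) =>
      (u (θ + cover L y) + u (θ - cover L y) - 2 * u θ) / ‖y‖ ^ (n + 1)).aestronglyMeasurable
  · fun_prop

/-- By Fubini the coefficient may be taken inside the integral over `y`, where the second difference
multiplies it by `-2(1 - cos⟨2πξ, y⟩)`. Integration over `y` then gives `cosIntegral` at `2πξ`. -/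
lemma HasSmallSecondDiff.coeff_halfLaplacianTorus (hL : 0 < L) (hu : HasSmallSecondDiff L C u)
    (hc : Continuous u) (hM : ∀ θ, |u θ| ≤ M) (k : Fin n → ℤ) :
    coeff (halfLaplacianTorus L u) k = symbol L k * coeff u k := by
  have hm := hc.measurable
  have hint : Integrable (fun θ => (u θ : ℂ)) (torusMeasure n) :=
    (Complex.continuous_ofReal.comp hc).integrable_of_hasCompactSupport
      (HasCompactSupport.of_compactSpace _)
  have hcoef : ∀ y : EuclideanSpace ℝ (Fin n), mFourierCoeff (fun θ =>
      (((u (θ + cover L y) + u (θ - cover L y) - 2 * u θ) / ‖y‖ ^ (n + 1) : ℝ) : ℂ)) k =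
      ((-2 * ((1 - Real.cos (inner ℝ ((2 * Real.pi) • freq L k) y)) / ‖y‖ ^ (n + 1)) : ℝ) : ℂ) *
        coeff u k := by
    intro y
    have i1 := hint.comp_add_right (cover L y)
    have i2 := hint.comp_add_right (-cover L y)
    have e : (fun θ => (((u (θ + cover L y) + u (θ - cover L y) - 2 * u θ) /
        ‖y‖ ^ (n + 1) : ℝ) : ℂ)) = fun θ => ((‖y‖ ^ (n + 1) : ℝ) : ℂ)⁻¹ *
          (((u (θ + cover L y) : ℂ) + (u (θ + -cover L y) : ℂ)) + (-2) * (u θ : ℂ)) := by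
      ext θ
      push_cast
      rw [← sub_eq_add_neg]
      ring
    rw [e, mFourierCoeff_const_mul, mFourierCoeff_add
        (f := fun θ => (u (θ + cover L y) : ℂ) + (u (θ + -cover L y) : ℂ))
        (i1.add i2) (hint.const_mul _), mFourierCoeff_add i1 i2, mFourierCoeff_const_mul,
      mFourierCoeff_comp_add (fun θ => (u θ : ℂ)), mFourierCoeff_comp_add (fun θ => (u θ : ℂ))]
    have h := mFourier_add_mFourier_neg (L := L) k y
    change _ * (_ * coeff u k + _ * coeff u k + _ * coeff u k) = _
    rw [mul_div_assoc', Complex.ofReal_div, ← h]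
    ring
  have hprod : Integrable (Function.uncurry fun (θ : UnitAddTorus (Fin n))
      (y : EuclideanSpace ℝ (Fin n)) =>
        (((u (θ + cover L y) + u (θ - cover L y) - 2 * u θ) / ‖y‖ ^ (n + 1) : ℝ) : ℂ))
      ((torusMeasure n).prod volume) := by
    have h1 := (integrable_const (μ := torusMeasure n) (1 : ℝ)).mul_prod
      (integrable_secondDiff_bound C hM)
    refine h1.mono' ?_ (Filter.Eventually.of_forall fun q => ?_)
    · exact (by fun_prop : Measurable fun q : UnitAddTorus (Fin n) × EuclideanSpace ℝ (Fin n) =>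
        (((u (q.1 + cover L q.2) + u (q.1 - cover L q.2) - 2 * u q.1) /
          ‖q.2‖ ^ (n + 1) : ℝ) : ℂ)).aestronglyMeasurable
    · rw [one_mul, Function.uncurry, Complex.norm_real]
      exact hu.norm_kernel_le hM _ _
  rw [coeff]
  simp only [halfLaplacianTorus, Complex.ofReal_mul, mFourierCoeff_const_mul]
  simp only [← integral_complex_ofReal]
  rw [mFourierCoeff_integral hprod]
  simp only [hcoef]
  rw [integral_mul_const, integral_complex_ofReal, integral_const_mul, ← mul_assoc,
    ← Complex.ofReal_mul]
  congr 2
  have hJ := cosIntegral_eq ((2 * Real.pi) • freq L k)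
  rw [cosIntegral, norm_smul, Real.norm_of_nonneg (by positivity)] at hJ
  rw [hJ, symbol_eq hL]
  have := (normConst_pos (n := n)).ne'
  field_simp

/-- A continuous function with small second differences whose Fourier coefficients satisfy
`|ξ| û = f̂` has half-Laplacian `f` everywhere, if `f` is continuous. -/
lemma HasSmallSecondDiff.halfLaplacian_eq (hL : 0 < L) (hu : HasSmallSecondDiff L C u)
    (hc : Continuous u) (hM : ∀ θ, |u θ| ≤ M) {f : UnitAddTorus (Fin n) → ℝ} (hf : Continuous f)
    (hfu : ∀ k, coeff f k = symbol L k * coeff u k) (x : EuclideanSpace ℝ (Fin n)) :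
    halfLaplacian (lift L u) x = f (cover L x) := by
  have h1 : Continuous fun θ => (halfLaplacianTorus L u θ : ℂ) :=
    Complex.continuous_ofReal.comp (hu.continuous_halfLaplacianTorus hc hM)
  have h2 : Continuous fun θ => (f θ : ℂ) := Complex.continuous_ofReal.comp hf
  have h := ae_eq_of_mFourierCoeff_eq
    (h1.memLp_of_hasCompactSupport (HasCompactSupport.of_compactSpace _))
    (h2.memLp_of_hasCompactSupport (HasCompactSupport.of_compactSpace _))
    (fun k => (hu.coeff_halfLaplacianTorus hL hc hM k).trans (hfu k).symm)
  -- Haar measure charges open sets, so continuous functions equal almost everywhere are equal.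
  have := congrFun ((h1.ae_eq_iff_eq _ h2).1 h) (cover L x)
  rw [halfLaplacian_lift]
  exact_mod_cast this

end

/-! ### Comparison with test functions. -/

section Viscosity

/-- The second differences of a `C²` function are locally quadratically small. -/
lemma exists_secondDiff_le_sq {V : Type*} [NormedAddCommGroup V] [NormedSpace ℝ V]
    [FiniteDimensional ℝ V] {ψ : V → ℝ} (hψ : ContDiff ℝ 2 ψ) (x : V) (r : ℝ) :
    ∃ C, 0 ≤ C ∧ ∀ y, ‖y‖ ≤ r → |ψ (x + y) + ψ (x - y) - 2 * ψ x| ≤ C * ‖y‖ ^ 2 := by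
  have hd : ContDiff ℝ 1 (fderiv ℝ ψ) := hψ.fderiv_right (by norm_num)
  obtain ⟨K, hK⟩ := hd.contDiffOn.exists_lipschitzOnWith (s := Metric.closedBall x r) one_ne_zero
    (convex_closedBall x r) (isCompact_closedBall x r)
  refine ⟨2 * K, by positivity, fun y hy => ?_⟩
  -- The mean value inequality is applied to `h ↦ ψ(x + h) + ψ(x - h)`, whose derivative is a
  -- difference of values of `Dψ` at distance `2|h|`.
  have hdiff : ∀ z, DifferentiableAt ℝ ψ z := fun z => hψ.differentiable (by norm_num) z
  have hderiv : ∀ h ∈ Metric.closedBall (0 : V) ‖y‖, HasFDerivWithinAt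
      (fun h => ψ (x + h) + ψ (x - h)) (fderiv ℝ ψ (x + h) - fderiv ℝ ψ (x - h))
      (Metric.closedBall (0 : V) ‖y‖) h := by
    intro h _
    have h1 := (hdiff (x + h)).hasFDerivAt.comp h ((hasFDerivAt_id h).const_add x)
    have h2 := (hdiff (x - h)).hasFDerivAt.comp h ((hasFDerivAt_id h).const_sub x)
    refine ((h1.add h2).congr_fderiv ?_).hasFDerivWithinAt
    ext v
    simp [sub_eq_add_neg]
  have hbound : ∀ h ∈ Metric.closedBall (0 : V) ‖y‖,
      ‖fderiv ℝ ψ (x + h) - fderiv ℝ ψ (x - h)‖ ≤ 2 * K * ‖y‖ := by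
    intro h hh
    have hh' : ‖h‖ ≤ ‖y‖ := by simpa using hh
    have := hK.norm_sub_le (x := x + h) (by simpa using hh'.trans hy) (y := x - h)
      (by simpa [dist_eq_norm] using hh'.trans hy)
    refine this.trans ?_
    have e : x + h - (x - h) = (2 : ℝ) • h := by rw [two_smul]; abel
    rw [e, norm_smul, Real.norm_ofNat]
    calc (K : ℝ) * (2 * ‖h‖) ≤ K * (2 * ‖y‖) := by gcongr
      _ = _ := by ring
  have := (convex_closedBall (0 : V) ‖y‖).norm_image_sub_le_of_norm_hasFDerivWithin_le hderiv
    hbound (x := 0) (by simp) (y := y) (by simp)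
  simp only [add_zero, sub_zero, Real.norm_eq_abs] at this
  calc _ = |ψ (x + y) + ψ (x - y) - (ψ x + ψ x)| := by rw [two_mul]
    _ ≤ _ := this
    _ = _ := by ring

lemma integrableOn_diffKernel_of_contDiff [NeZero n] {ψ : EuclideanSpace ℝ (Fin n) → ℝ}
    (hψ : ContDiff ℝ 2 ψ) (x : EuclideanSpace ℝ (Fin n)) {r : ℝ} :
    IntegrableOn (diffKernel ψ x) (Metric.ball 0 r) := by
  obtain ⟨C, hC0, hC⟩ := exists_secondDiff_le_sq hψ x r
  have hm := hψ.continuous.measurable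
  refine ((integrable_min_rpow_div (n := n) (A := C * r ^ 2) (B := C) (s := 2) (by positivity) hC0
    (by norm_num)).integrableOn (s := Metric.ball 0 r)).mono' ?_ ?_
  · unfold diffKernel
    exact (by fun_prop : Measurable fun y =>
      (ψ (x + y) + ψ (x - y) - 2 * ψ x) / ‖y‖ ^ (n + 1)).aestronglyMeasurable
  · filter_upwards [ae_restrict_mem measurableSet_ball] with y hy
    have hy' : ‖y‖ ≤ r := (by simpa using hy : ‖y‖ < r).le
    rw [diffKernel, norm_div, norm_pow, norm_norm, Real.norm_eq_abs, Real.rpow_two]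
    gcongr
    exact le_min ((hC y hy').trans (by gcongr)) (hC y hy')

lemma diffKernel_neg (w : EuclideanSpace ℝ (Fin n) → ℝ) (x y : EuclideanSpace ℝ (Fin n)) :
    diffKernel (fun z => -w z) x y = -diffKernel w x y := by
  simp only [diffKernel]
  ring

/-- At a maximum of `w - ψ` the increments of `w` to `x + y` and `x - y` are at most those of `ψ`,
so the kernels compare pointwise in the ball. -/
lemma setIntegral_diffKernel_le [NeZero n] {w ψ : EuclideanSpace ℝ (Fin n) → ℝ}
    {x : EuclideanSpace ℝ (Fin n)} (hw : Integrable (diffKernel w x)) (hψ : ContDiff ℝ 2 ψ)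
    {r : ℝ} (hmax : IsMaxOn (fun y => w y - ψ y) (Metric.ball x r) x) :
    ∫ y, diffKernel w x y ≤ (∫ y in Metric.ball 0 r, diffKernel ψ x y) +
      ∫ y in (Metric.ball 0 r)ᶜ, diffKernel w x y := by
  rw [← integral_add_compl measurableSet_ball hw]
  refine add_le_add_left ?_ _
  refine setIntegral_mono_on hw.integrableOn (integrableOn_diffKernel_of_contDiff hψ x)
    measurableSet_ball fun y hy => ?_
  have hy' : ‖y‖ < r := by simpa using hy
  have h1 : w (x + y) - ψ (x + y) ≤ w x - ψ x := hmax (by simpa using hy')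
  have h2 : w (x - y) - ψ (x - y) ≤ w x - ψ x := hmax (by simpa [dist_eq_norm] using hy')
  unfold diffKernel
  gcongr ?_ / _
  linarith

lemma le_setIntegral_diffKernel [NeZero n] {w ψ : EuclideanSpace ℝ (Fin n) → ℝ}
    {x : EuclideanSpace ℝ (Fin n)} (hw : Integrable (diffKernel w x)) (hψ : ContDiff ℝ 2 ψ)
    {r : ℝ} (hmin : IsMinOn (fun y => w y - ψ y) (Metric.ball x r) x) :
    (∫ y in Metric.ball 0 r, diffKernel ψ x y) +
      ∫ y in (Metric.ball 0 r)ᶜ, diffKernel w x y ≤ ∫ y, diffKernel w x y := by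
  have h := setIntegral_diffKernel_le (w := fun z => -w z) (ψ := fun z => -ψ z) (x := x) (r := r)
    (hw.neg.congr (Filter.Eventually.of_forall fun y => (diffKernel_neg w x y).symm)) hψ.neg
    (fun y hy => by
      have := hmin hy
      simp only [Set.mem_ofPred_eq] at this ⊢
      linarith)
  simp only [diffKernel_neg, integral_neg] at h
  linarith

/-- A continuous classical solution is a viscosity solution. -/
lemma IsClassicalSolution.isViscositySolution [NeZero n]
    {φ : UnitAddTorus (Fin n) → ℝ → ℝ} {F : ℝ} {u : UnitAddTorus (Fin n) → ℝ}
    (hu : IsClassicalSolution L φ F u) (hc : Continuous u) : IsViscositySolution L φ F u where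
  continuous := hc
  subsolution x r _ ψ hψ hmax := by
    have h := setIntegral_diffKernel_le (hu.integrable x) hψ hmax
    have he := hu.equation x
    have hn := mul_le_mul_of_nonneg_left h (by linarith [normConst_nonneg (n := n)] :
      0 ≤ normConst n / 2)
    rw [halfLaplacian] at he
    rw [mixedHalfLaplacian]
    linarith
  supersolution x r _ ψ hψ hmin := by
    have h := le_setIntegral_diffKernel (hu.integrable x) hψ hmin
    have he := hu.equation x
    have hn := mul_le_mul_of_nonneg_left h (by linarith [normConst_nonneg (n := n)] :
      0 ≤ normConst n / 2)
    rw [halfLaplacian] at he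
    rw [mixedHalfLaplacian]
    linarith

end Viscosity

end Singular

/-! ### Representation by potentials and their regularity. -/

section Regularity

open UnitAddTorus

variable {n : ℕ} {L : ℝ}

/-- Lets continuity descend from the lift to the torus. Openness of the one-dimensional quotient
maps matters, since it passes to products. -/
lemma isQuotientMap_cover (hL : L ≠ 0) :
    Topology.IsQuotientMap (cover L : EuclideanSpace ℝ (Fin n) → UnitAddTorus (Fin n)) := by
  have h1 : IsOpenQuotientMap (Pi.map fun (_ : Fin n) (y : ℝ) => (y : UnitAddCircle)) :=
    IsOpenQuotientMap.piMap fun _ => QuotientAddGroup.isOpenQuotientMap_mk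
  have h2 := (Homeomorph.smulOfNeZero (α := Fin n → ℝ) L⁻¹ (inv_ne_zero hL)).isQuotientMap
  have h3 := (PiLp.homeomorph 2 (fun _ : Fin n => ℝ)).isQuotientMap
  convert! h1.isQuotientMap.comp (h2.comp h3) using 1
  ext x i
  simp [cover, div_eq_inv_mul, PiLp.homeomorph]

lemma continuous_of_continuous_lift (hL : L ≠ 0) {u : UnitAddTorus (Fin n) → ℝ}
    (hu : Continuous (lift L u)) : Continuous u :=
  (isQuotientMap_cover hL).continuous_iff.2 hu

lemma continuous_of_holder {V : Type*} [NormedAddCommGroup V] {w : V → ℝ} {C : ℝ}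
    (hw : ∀ x h, |w (x + h) - w x| ≤ C * ‖h‖ ^ (1 / 2 : ℝ)) : Continuous w := by
  rw [continuous_iff_continuousAt]
  intro x
  rw [ContinuousAt, tendsto_iff_norm_sub_tendsto_zero]
  refine squeeze_zero (fun _ => norm_nonneg _)
    (g := fun y => C * ‖y - x‖ ^ (1 / 2 : ℝ)) (fun y => ?_) ?_
  · simpa using hw x (y - x)
  · have : Continuous fun y : V => C * ‖y - x‖ ^ (1 / 2 : ℝ) :=
      continuous_const.mul ((continuous_id.sub continuous_const).norm.rpow_const
        fun _ => Or.inr (by norm_num))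
    simpa using this.tendsto x

lemma stronglyMeasurable_heatTorus {F : Type*} [NormedAddCommGroup F] [NormedSpace ℝ F]
    [MeasurableSpace F] [BorelSpace F] [SecondCountableTopology F]
    {f : UnitAddTorus (Fin n) → F} (hf : Measurable f) :
    StronglyMeasurable fun q : UnitAddTorus (Fin n) × ℝ => heatTorus L q.2 f q.1 := by
  unfold heatTorus
  refine StronglyMeasurable.integral_prod_right (f := fun (q : UnitAddTorus (Fin n) × ℝ)
    (z : EuclideanSpace ℝ (Fin n)) => gauss z • f (q.1 + cover L (q.2 • z))) ?_
  exact (by fun_prop : Measurable fun p : (UnitAddTorus (Fin n) × ℝ) × EuclideanSpace ℝ (Fin n) =>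
    gauss p.2 • f (p.1.1 + cover L (p.1.2 • p.2))).stronglyMeasurable

lemma stronglyMeasurable_rieszTorus {f : UnitAddTorus (Fin n) → ℝ} (hf : Measurable f) :
    StronglyMeasurable (rieszTorus L f) := by
  unfold rieszTorus
  exact StronglyMeasurable.integral_prod_right' (stronglyMeasurable_heatTorus hf)

lemma abs_rieszTorus_le {f : UnitAddTorus (Fin n) → ℝ} {M : ℝ} (hM : ∀ θ, |f θ| ≤ M)
    (θ : UnitAddTorus (Fin n)) : |rieszTorus L f θ| ≤ M := by
  have := norm_setIntegral_le_of_norm_le_const (μ := volume) (s := Set.Ioc (0 : ℝ) 1)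
    (f := fun t => heatTorus L t f θ) (C := M) (by simp) (fun t _ => norm_heatTorus_le hM t θ)
  simpa [rieszTorus] using this

/-- The function with half-Laplacian `f` that the remainder `ρ` determines. -/
def potential (L : ℝ) (ρ f : UnitAddTorus (Fin n) → ℝ) (θ : UnitAddTorus (Fin n)) : ℝ :=
  Real.pi⁻¹ * rieszTorus L f θ + heatTorus L (1 / 2) ρ θ

/-- A square-integrable function is recovered from its half-Laplacian `f`, if that is bounded, as a
potential with continuous remainder. -/
lemma exists_ae_eq_potential (hL : 0 < L) {g : UnitAddTorus (Fin n) → ℝ}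
    (hg : MemLp g 2 (torusMeasure n)) :
    ∃ ρ : UnitAddTorus (Fin n) → ℝ, Continuous ρ ∧
      ∀ f : UnitAddTorus (Fin n) → ℝ, Measurable f → (∃ M, ∀ θ, |f θ| ≤ M) →
        (∀ k, coeff f k = symbol L k * coeff g k) →
        g =ᵐ[torusMeasure n] potential L ρ f := by
  -- `ρ` depends on `g` alone, so one remainder serves both forces in the bootstrap.
  obtain ⟨ρ, hρ⟩ := exists_continuous_remainder hL g
  refine ⟨fun θ => (ρ θ).re, Complex.continuous_re.comp ρ.continuous, fun f hf ⟨M, hM⟩ hfg => ?_⟩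
  have hρM : ∀ θ, ‖ρ θ‖ ≤ ‖ρ‖ := ρ.norm_coe_le_norm
  have hρm : Measurable ρ := ρ.continuous.measurable
  set w : UnitAddTorus (Fin n) → ℂ := fun θ => (rieszTorus L f θ : ℂ) with hw
  set v : UnitAddTorus (Fin n) → ℂ := heatTorus L (1 / 2) ρ with hv
  have hwL : MemLp w 2 (torusMeasure n) :=
    MemLp.of_bound (Complex.continuous_ofReal.comp_stronglyMeasurable
      (stronglyMeasurable_rieszTorus hf)).aestronglyMeasurable M
      (Filter.Eventually.of_forall fun θ => by
        rw [hw, Complex.norm_real]; exact abs_rieszTorus_le hM θ)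
  have hvL : MemLp v 2 (torusMeasure n) :=
    MemLp.of_bound ((stronglyMeasurable_heatTorus hρm).comp_measurable
      (g := fun θ => (θ, 1 / 2)) (by fun_prop)).aestronglyMeasurable ‖ρ‖
      (Filter.Eventually.of_forall fun θ => norm_heatTorus_le hρM _ θ)
  have hwL' : MemLp (fun θ => (Real.pi : ℂ)⁻¹ * w θ) 2 (torusMeasure n) := hwL.const_mul _
  have h := ae_eq_of_mFourierCoeff_eq (f := fun θ => (g θ : ℂ)) hg.ofReal (hwL'.add hvL) fun k => by
    have e := mFourierCoeff_add (hwL'.integrable one_le_two) (hvL.integrable one_le_two) k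
    rw [mFourierCoeff_const_mul] at e
    have e1 : mFourierCoeff w k = rieszMult ‖freq L k‖ * coeff f k :=
      mFourierCoeff_rieszTorus hf hM k
    have e2 := mFourierCoeff_heatTorus (L := L) hρm hρM (1 / 2) k
    refine Eq.trans ?_ e.symm
    -- With `m` the multiplier, this is `ĝ = π⁻¹ m (2π|ξ| ĝ) + (1 - 2|ξ| m) ĝ`.
    rw [e1, hv, e2, hρ, hfg, symbol_eq hL]
    have hpi : (Real.pi : ℂ) ≠ 0 := by exact_mod_cast Real.pi_ne_zero
    change coeff g k = _
    push_cast
    field_simp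
    ring
  filter_upwards [h] with θ hθ
  have := congrArg Complex.re hθ
  simp only [Pi.add_apply, Complex.add_re, Complex.ofReal_re] at this
  rw [this, potential]
  congr 1
  · rw [hw, ← Complex.ofReal_inv, ← Complex.ofReal_mul, Complex.ofReal_re]
  · have hint : Integrable fun z : EuclideanSpace ℝ (Fin n) =>
        gauss z • ρ (θ + cover L ((1 / 2 : ℝ) • z)) := by
      refine (integrable_gauss.mul_const ‖ρ‖).mono' ?_ (Filter.Eventually.of_forall fun z => ?_)
      · exact (by fun_prop : Measurable fun z : EuclideanSpace ℝ (Fin n) =>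
          gauss z • ρ (θ + cover L ((1 / 2 : ℝ) • z))).aestronglyMeasurable
      · rw [norm_smul, Real.norm_of_nonneg (gauss_pos z).le]
        exact mul_le_mul_of_nonneg_left (hρM _) (gauss_pos z).le
    have := Complex.reCLM.integral_comp_comm hint
    simp only [Complex.reCLM_apply, Complex.smul_re] at this
    rw [hv, heatTorus, ← this, heatTorus]

lemma lift_potential (ρ f : UnitAddTorus (Fin n) → ℝ) (x : EuclideanSpace ℝ (Fin n)) :
    lift L (potential L ρ f) x =
      Real.pi⁻¹ * rieszMean (lift L f) x + heat (1 / 2) (lift L ρ) x := by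
  rw [← lift_rieszTorus, ← lift_heatTorus]
  rfl

lemma measurable_lift {f : UnitAddTorus (Fin n) → ℝ} (hf : Measurable f) :
    Measurable (lift L f) := hf.comp measurable_cover

/-- Potentials of bounded functions are Hölder continuous of exponent `1 / 2`. -/
lemma exists_potential_holder {ρ f : UnitAddTorus (Fin n) → ℝ} (hρ : Measurable ρ) {R : ℝ}
    (hR : ∀ θ, |ρ θ| ≤ R) (hf : Measurable f) {M : ℝ} (hM : ∀ θ, |f θ| ≤ M) :
    ∃ C, 0 ≤ C ∧ ∀ x h : EuclideanSpace ℝ (Fin n),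
      |lift L (potential L ρ f) (x + h) - lift L (potential L ρ f) x| ≤
        C * ‖h‖ ^ (1 / 2 : ℝ) := by
  have hM0 : 0 ≤ M := (abs_nonneg _).trans (hM 0)
  have hR0 : 0 ≤ R := (abs_nonneg _).trans (hR 0)
  set I := ∫ z : EuclideanSpace ℝ (Fin n), gaussMajorant z with hI
  have hI0 : 0 ≤ I := integral_nonneg fun z => (gaussMajorant_pos z).le
  have hpi := Real.pi_pos
  refine ⟨Real.pi⁻¹ * (4 * I * M) + 2 * I * R * 2 ^ (1 / 2 : ℝ), by positivity, fun x h => ?_⟩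
  have h1 := abs_rieszMean_add_sub_le (measurable_lift (L := L) hf) (fun x => hM (cover L x)) x h
  have h2 := abs_heat_add_sub_le (measurable_lift (L := L) hρ) (fun x => hR (cover L x))
    (t := 1 / 2) (by norm_num) x h
  have e : ‖(1 / 2 : ℝ)⁻¹ • h‖ ^ (1 / 2 : ℝ) = 2 ^ (1 / 2 : ℝ) * ‖h‖ ^ (1 / 2 : ℝ) := by
    rw [norm_smul, Real.mul_rpow (norm_nonneg _) (norm_nonneg h)]
    norm_num
  rw [e] at h2
  rw [lift_potential, lift_potential]
  calc _ = |Real.pi⁻¹ * (rieszMean (lift L f) (x + h) - rieszMean (lift L f) x) +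
        (heat (1 / 2) (lift L ρ) (x + h) - heat (1 / 2) (lift L ρ) x)| := by
        congr 1
        ring
    _ ≤ Real.pi⁻¹ * |rieszMean (lift L f) (x + h) - rieszMean (lift L f) x| +
        |heat (1 / 2) (lift L ρ) (x + h) - heat (1 / 2) (lift L ρ) x| := by
        refine (abs_add_le _ _).trans (le_of_eq ?_)
        rw [abs_mul, abs_of_pos (inv_pos.2 hpi)]
    _ ≤ Real.pi⁻¹ * (4 * I * M * ‖h‖ ^ (1 / 2 : ℝ)) +
        2 * I * R * (2 ^ (1 / 2 : ℝ) * ‖h‖ ^ (1 / 2 : ℝ)) := by gcongr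
    _ = _ := by ring

/-- Potentials of Hölder continuous functions of exponent `1 / 2` have a first-order Taylor
expansion with remainder of order `|h| ^ (5 / 4)`. -/
lemma exists_potential_taylor {ρ f : UnitAddTorus (Fin n) → ℝ} (hρ : Measurable ρ) {R : ℝ}
    (hR : ∀ θ, |ρ θ| ≤ R) (hf : Measurable f) {M : ℝ} (hM : ∀ θ, |f θ| ≤ M) {K : ℝ}
    (hK : ∀ x : EuclideanSpace ℝ (Fin n), ∀ t ∈ Set.Ioc (0 : ℝ) 1, ∀ z,
      |lift L f (x + t • z) - lift L f x| ≤ K * t ^ (1 / 2 : ℝ) * (1 + ‖z‖)) :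
    ∃ (C : ℝ) (G : EuclideanSpace ℝ (Fin n) → EuclideanSpace ℝ (Fin n)), ∀ x h,
      |lift L (potential L ρ f) (x + h) - lift L (potential L ρ f) x - inner ℝ (G x) h| ≤
        C * ‖h‖ ^ (5 / 4 : ℝ) := by
  have hR0 : 0 ≤ R := (abs_nonneg _).trans (hR 0)
  set I := ∫ z : EuclideanSpace ℝ (Fin n), gaussMajorant z with hI
  have hpi := Real.pi_pos
  refine ⟨Real.pi⁻¹ * (48 * I * K) + 12 * I * (2 * R) * 2 ^ (5 / 4 : ℝ),
    fun x => Real.pi⁻¹ • rieszMeanGrad (lift L f) x + heatGrad (1 / 2) (lift L ρ) x,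
    fun x h => ?_⟩
  have h1 := abs_rieszMean_taylor_le (measurable_lift (L := L) hf) (fun x => hM (cover L x))
    (hK x) h
  -- At the fixed scale `1/2` nothing has to be integrated in `t`, so boundedness of `ρ` suffices.
  have hρ2 : ∀ z : EuclideanSpace ℝ (Fin n),
      |lift L ρ (x + (1 / 2 : ℝ) • z) - lift L ρ x| ≤ 2 * R * (1 + ‖z‖) := by
    intro z
    have a := hR (cover L (x + (1 / 2 : ℝ) • z))
    have b := hR (cover L x)
    calc _ ≤ R + R := (abs_sub _ _).trans (add_le_add a b)
      _ ≤ _ := by nlinarith [mul_nonneg hR0 (norm_nonneg z)]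
  have h2 := abs_heat_taylor_le (measurable_lift (L := L) hρ) (fun x => hR (cover L x))
    (t := 1 / 2) (by norm_num) hρ2 h
  have e : ‖(1 / 2 : ℝ)⁻¹ • h‖ ^ (5 / 4 : ℝ) = 2 ^ (5 / 4 : ℝ) * ‖h‖ ^ (5 / 4 : ℝ) := by
    rw [norm_smul, Real.mul_rpow (norm_nonneg _) (norm_nonneg h)]
    norm_num
  rw [e] at h2
  rw [lift_potential, lift_potential, inner_add_left, real_inner_smul_left]
  calc _ = |Real.pi⁻¹ * (rieszMean (lift L f) (x + h) - rieszMean (lift L f) x -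
          inner ℝ (rieszMeanGrad (lift L f) x) h) +
        (heat (1 / 2) (lift L ρ) (x + h) - heat (1 / 2) (lift L ρ) x -
          inner ℝ (heatGrad (1 / 2) (lift L ρ) x) h)| := by
        congr 1
        ring
    _ ≤ Real.pi⁻¹ * |rieszMean (lift L f) (x + h) - rieszMean (lift L f) x -
          inner ℝ (rieszMeanGrad (lift L f) x) h| +
        |heat (1 / 2) (lift L ρ) (x + h) - heat (1 / 2) (lift L ρ) x -
          inner ℝ (heatGrad (1 / 2) (lift L ρ) x) h| := by
        refine (abs_add_le _ _).trans (le_of_eq ?_)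
        rw [abs_mul, abs_of_pos (inv_pos.2 hpi)]
    _ ≤ Real.pi⁻¹ * (48 * I * K * ‖h‖ ^ (5 / 4 : ℝ)) +
        12 * I * (2 * R) * (2 ^ (5 / 4 : ℝ) * ‖h‖ ^ (5 / 4 : ℝ)) := by gcongr
    _ = _ := by ring

/-- The linear terms at `y` and `-y` cancel, leaving two remainders. -/
lemma hasSmallSecondDiff_of_taylor (hL : L ≠ 0) {u : UnitAddTorus (Fin n) → ℝ} {C : ℝ}
    {G : EuclideanSpace ℝ (Fin n) → EuclideanSpace ℝ (Fin n)}
    (hC : ∀ x h, |lift L u (x + h) - lift L u x - inner ℝ (G x) h| ≤ C * ‖h‖ ^ (5 / 4 : ℝ)) :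
    HasSmallSecondDiff L (2 * C) u := by
  intro θ y
  obtain ⟨x, rfl⟩ := cover_surjective hL θ
  have h1 := hC x y
  have h2 := hC x (-y)
  rw [norm_neg, inner_neg_right, ← sub_eq_add_neg] at h2
  simp only [lift, cover_add, cover_sub] at h1 h2
  rw [abs_le] at *
  constructor <;> linarith [h1.1, h1.2, h2.1, h2.2]

end Regularity

/-! ### The force along a solution, and the weak equation in Fourier space. -/

section Equation

open UnitAddTorus

variable {n : ℕ} {L F : ℝ} {φ : UnitAddTorus (Fin n) → ℝ → ℝ}

lemma IsWigglyForce.continuous (hφ : IsWigglyForce φ) :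
    Continuous fun p : UnitAddTorus (Fin n) × ℝ => φ p.1 p.2 := by
  obtain ⟨K, hK⟩ := hφ.lipschitz
  exact hK.continuous

/-- Periodicity reduces the bound to a compact set. This bound, uniform in `y`, starts the
bootstrap, when nothing is known about the size of `g`. -/
lemma IsWigglyForce.exists_bound (hφ : IsWigglyForce φ) (F : ℝ) :
    ∃ M, ∀ θ y, |φ θ y + F| ≤ M := by
  have hc : IsCompact ((Set.univ : Set (UnitAddTorus (Fin n))) ×ˢ Set.Icc (0 : ℝ) 1) :=
    isCompact_univ.prod isCompact_Icc
  obtain ⟨M, hM⟩ := hc.exists_bound_of_continuousOn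
    (hφ.continuous.add continuous_const : Continuous fun p => φ p.1 p.2 + F).continuousOn
  refine ⟨M, fun θ y => ?_⟩
  obtain ⟨z, hz, hzy⟩ := (hφ.periodic θ).exists_mem_Ico₀ one_pos y
  rw [hzy]
  exact hM (θ, z) ⟨Set.mem_univ _, Set.Ico_subset_Icc_self hz⟩

lemma contDiff_lift_re_mFourier (k : Fin n → ℤ) :
    ContDiff ℝ ∞ (lift L fun θ => (mFourier k θ).re) := by
  unfold lift
  simp only [mFourier_cover, Complex.exp_ofReal_mul_I_re]
  exact Real.contDiff_cos.comp (contDiff_const.mul (contDiff_const.inner ℝ contDiff_id))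

lemma contDiff_lift_im_mFourier (k : Fin n → ℤ) :
    ContDiff ℝ ∞ (lift L fun θ => (mFourier k θ).im) := by
  unfold lift
  simp only [mFourier_cover, Complex.exp_ofReal_mul_I_im]
  exact Real.contDiff_sin.comp (contDiff_const.mul (contDiff_const.inner ℝ contDiff_id))

/-- The weak equation in terms of Fourier coefficients. -/
lemma IsWeakSolution.coeff_eq (hφ : IsWigglyForce φ) {g : UnitAddTorus (Fin n) → ℝ}
    (hg : IsWeakSolution L φ F g) (k : Fin n → ℤ) :
    coeff (fun θ => φ θ (g θ) + F) k = symbol L k * coeff g k := by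
  obtain ⟨M, hM⟩ := hφ.exists_bound F
  have hgm : AEMeasurable g (torusMeasure n) :=
    hg.memHHalf.1.aestronglyMeasurable.aemeasurable
  have hfm : AEMeasurable (fun θ => φ θ (g θ) + F) (torusMeasure n) :=
    (hφ.continuous.measurable.comp_aemeasurable (aemeasurable_id.prodMk hgm)).add_const F
  have hint : Integrable (fun θ => φ θ (g θ) + F) (torusMeasure n) :=
    Integrable.mono' (integrable_const M) hfm.aestronglyMeasurable
      (Filter.Eventually.of_forall fun θ => hM θ (g θ))
  have hre : Continuous fun θ => (mFourier k θ).re :=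
    Complex.continuous_re.comp (mFourier k).continuous
  have him : Continuous fun θ => (mFourier k θ).im :=
    Complex.continuous_im.comp (mFourier k).continuous
  have hbre : ∀ θ, ‖(mFourier k θ).re‖ ≤ 1 := fun θ =>
    (Complex.abs_re_le_norm _).trans (norm_mFourier_apply k θ).le
  have hbim : ∀ θ, ‖(mFourier k θ).im‖ ≤ 1 := fun θ =>
    (Complex.abs_im_le_norm _).trans (norm_mFourier_apply k θ).le
  have i1 : Integrable (fun θ => (φ θ (g θ) + F) * (mFourier k θ).re) (torusMeasure n) :=
    hint.mul_bdd (c := 1) hre.aestronglyMeasurable (Filter.Eventually.of_forall hbre)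
  have i2 : Integrable (fun θ => (φ θ (g θ) + F) * (mFourier k θ).im) (torusMeasure n) :=
    hint.mul_bdd (c := 1) him.aestronglyMeasurable (Filter.Eventually.of_forall hbim)
  -- Test functions are real, so the real and imaginary parts of the character are tested
  -- separately; the factor `-i` on the second recombines them into its conjugate.
  have s1 := hg.weak_eq _ (contDiff_lift_re_mFourier k)
  have s2 := hg.weak_eq _ (contDiff_lift_im_mFourier k)
  have s := s1.add (s2.mul_left (-Complex.I))
  have hterm : ∀ j, (symbol L j : ℂ) * (coeff g j * star (coeff (fun θ => (mFourier k θ).re) j)) +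
      -Complex.I * ((symbol L j : ℂ) *
        (coeff g j * star (coeff (fun θ => (mFourier k θ).im) j))) =
      if j = k then (symbol L k : ℂ) * coeff g k else 0 := by
    intro j
    have h := mFourierCoeff_mFourier k j
    have e : (fun θ => mFourier k θ) = fun θ =>
        (((mFourier k θ).re : ℝ) : ℂ) + Complex.I * (((mFourier k θ).im : ℝ) : ℂ) := by
      ext θ
      rw [mul_comm, Complex.re_add_im]
    have j1 : Integrable (fun θ => (((mFourier k θ).re : ℝ) : ℂ)) (torusMeasure n) :=
      (Complex.continuous_ofReal.comp hre).integrable_of_hasCompactSupport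
        (HasCompactSupport.of_compactSpace _)
    have j2 : Integrable (fun θ => (((mFourier k θ).im : ℝ) : ℂ)) (torusMeasure n) :=
      (Complex.continuous_ofReal.comp him).integrable_of_hasCompactSupport
        (HasCompactSupport.of_compactSpace _)
    rw [e, mFourierCoeff_add j1 (j2.const_mul _), mFourierCoeff_const_mul] at h
    have h' := congrArg star h
    rw [star_add, star_mul', show star Complex.I = -Complex.I from Complex.conj_I] at h'
    change star (coeff (fun θ => (mFourier k θ).re) j) +
      -Complex.I * star (coeff (fun θ => (mFourier k θ).im) j) = _ at h'
    have e2 : (symbol L j : ℂ) * (coeff g j * star (coeff (fun θ => (mFourier k θ).re) j)) +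
        -Complex.I * ((symbol L j : ℂ) *
          (coeff g j * star (coeff (fun θ => (mFourier k θ).im) j))) =
        (symbol L j : ℂ) * coeff g j * star (if j = k then (1 : ℂ) else 0) := by
      rw [← h']; ring
    rw [e2]
    split_ifs with hjk
    · simp [hjk]
    · simp
  simp only [hterm] at s
  rw [s.unique (hasSum_ite_eq k _) |>.symm, coeff, mFourierCoeff_eq,
    ← integral_complex_ofReal, ← integral_complex_ofReal, ← integral_const_mul,
    ← integral_add i1.ofReal (i2.ofReal.const_mul _)]
  congr 1 with θ
  rw [mFourier_neg]
  apply Complex.ext <;> simp <;> ring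

/-- The force along a Hölder continuous function of exponent `1 / 2` is Hölder continuous of the
same exponent. -/
lemma IsWigglyForce.exists_holder_comp (hL : 0 < L) (hφ : IsWigglyForce φ) (F : ℝ)
    {u : UnitAddTorus (Fin n) → ℝ} {C : ℝ} (hC0 : 0 ≤ C)
    (hC : ∀ x h, |lift L u (x + h) - lift L u x| ≤ C * ‖h‖ ^ (1 / 2 : ℝ)) :
    ∃ K, ∀ x : EuclideanSpace ℝ (Fin n), ∀ t ∈ Set.Ioc (0 : ℝ) 1, ∀ z,
      |lift L (fun θ => φ θ (u θ) + F) (x + t • z) - lift L (fun θ => φ θ (u θ) + F) x| ≤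
        K * t ^ (1 / 2 : ℝ) * (1 + ‖z‖) := by
  obtain ⟨K, hK⟩ := hφ.lipschitz
  -- The term `1 / L` is the Lipschitz constant of the covering map and `C` the Hölder constant of
  -- `u`. Since `t ≤ 1`, both `t|z|` and `|t z|^(1/2)` are at most `t^(1/2) (1 + |z|)`.
  refine ⟨K * (1 / L + C), fun x t ht z => ?_⟩
  have hts : t ≤ t ^ (1 / 2 : ℝ) := Real.self_le_rpow_of_le_one ht.1.le ht.2 (by norm_num)
  have ht0 : 0 ≤ t ^ (1 / 2 : ℝ) := Real.rpow_nonneg ht.1.le _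
  have hn : ‖t • z‖ = t * ‖z‖ := by rw [norm_smul, Real.norm_of_nonneg ht.1.le]
  have hz : ‖z‖ ^ (1 / 2 : ℝ) ≤ 1 + ‖z‖ := by
    rcases le_total ‖z‖ 1 with h | h
    · linarith [Real.rpow_le_one (norm_nonneg z) h (by norm_num : (0 : ℝ) ≤ 1 / 2), norm_nonneg z]
    · linarith [Real.rpow_le_self_of_one_le h (by norm_num : (1 / 2 : ℝ) ≤ 1)]
  have h1 : ‖cover L (x + t • z) - cover L x‖ ≤ 1 / L * t ^ (1 / 2 : ℝ) * (1 + ‖z‖) := by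
    rw [cover_add, add_sub_cancel_left]
    calc _ ≤ ‖t • z‖ / L := norm_cover_le hL _
      _ = 1 / L * t * ‖z‖ := by rw [hn]; ring
      _ ≤ _ := by gcongr; linarith
  have h2 : |u (cover L (x + t • z)) - u (cover L x)| ≤ C * t ^ (1 / 2 : ℝ) * (1 + ‖z‖) := by
    calc _ ≤ C * ‖t • z‖ ^ (1 / 2 : ℝ) := hC x (t • z)
      _ = C * t ^ (1 / 2 : ℝ) * ‖z‖ ^ (1 / 2 : ℝ) := by
        rw [hn, Real.mul_rpow ht.1.le (norm_nonneg z)]; ring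
      _ ≤ _ := by gcongr
  have h3 := hK.dist_le_mul (cover L (x + t • z), u (cover L (x + t • z)))
    (cover L x, u (cover L x))
  rw [Prod.dist_eq, dist_eq_norm, dist_eq_norm, dist_eq_norm] at h3
  simp only [Real.norm_eq_abs] at h3
  simp only [lift, add_sub_add_right_eq_sub]
  refine h3.trans ?_
  have hA : 0 ≤ 1 / L * t ^ (1 / 2 : ℝ) * (1 + ‖z‖) := by positivity
  have hB : 0 ≤ C * t ^ (1 / 2 : ℝ) * (1 + ‖z‖) := by positivity
  calc _ ≤ (K : ℝ) * (1 / L * t ^ (1 / 2 : ℝ) * (1 + ‖z‖) +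
        C * t ^ (1 / 2 : ℝ) * (1 + ‖z‖)) := by
        gcongr
        exact max_le (h1.trans (by linarith)) (h2.trans (by linarith))
    _ = _ := by ring

end Equation

end

end StickSlip

/-! ### The bootstrap. -/

open StickSlip in
theorem proposition3p4 (n : ℕ) [NeZero n] (L : ℝ) (hL : 0 < L)
    (φ : UnitAddTorus (Fin n) → ℝ → ℝ) (hφ : StickSlip.IsWigglyForce φ)
    (F : ℝ) (hF : 0 ≤ F)
    (g : UnitAddTorus (Fin n) → ℝ) (hg : StickSlip.IsWeakSolution L φ F g) :
    ∃ u : UnitAddTorus (Fin n) → ℝ,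
      g =ᵐ[StickSlip.torusMeasure n] u ∧
      StickSlip.IsClassicalSolution L φ F u ∧
      StickSlip.IsViscositySolution L φ F u := by
  obtain ⟨M, hM⟩ := hφ.exists_bound F
  obtain ⟨ρ, hρc, hρ⟩ := exists_ae_eq_potential hL hg.memHHalf.1
  obtain ⟨R, hR⟩ := isCompact_univ.exists_bound_of_continuousOn hρc.continuousOn
  replace hR : ∀ θ, |ρ θ| ≤ R := fun θ => hR θ (Set.mem_univ θ)
  have hφm := hφ.continuous.measurable
  have hcoeff : ∀ w : UnitAddTorus (Fin n) → ℝ, g =ᵐ[torusMeasure n] w → ∀ k,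
      coeff (fun θ => φ θ (w θ) + F) k = symbol L k * coeff g k := fun w hw k => by
    rw [← hg.coeff_eq hφ k]
    exact mFourierCoeff_congr_ae (hw.mono fun θ hθ => by simp only [hθ]) k
  have hgm := hg.memHHalf.1.aestronglyMeasurable
  -- `g` is measurable only up to a null set; a measurable representative makes the force
  -- measurable, as the potential estimates require.
  set f₁ : UnitAddTorus (Fin n) → ℝ := fun θ => φ θ (hgm.mk g θ) + F with hf₁
  have hf₁m : Measurable f₁ :=
    (hφm.comp (measurable_id.prodMk hgm.stronglyMeasurable_mk.measurable)).add_const F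
  have hf₁M : ∀ θ, |f₁ θ| ≤ M := fun θ => hM θ _
  set u := potential L ρ f₁ with hu
  have hgu : g =ᵐ[torusMeasure n] u := hρ f₁ hf₁m ⟨M, hf₁M⟩ (hcoeff _ hgm.ae_eq_mk)
  obtain ⟨C₁, hC₁0, hC₁⟩ := exists_potential_holder (L := L) hρc.measurable hR hf₁m hf₁M
  have huc : Continuous u := continuous_of_continuous_lift hL.ne' (continuous_of_holder hC₁)
  -- Second pass: the force along the Hölder representative has the same Fourier coefficients and is
  -- now Hölder. Its potential with the same `ρ` is continuous and equals `g` almost everywhere,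
  -- hence equals `u` everywhere.
  set f : UnitAddTorus (Fin n) → ℝ := fun θ => φ θ (u θ) + F with hf
  have hfc : Continuous f :=
    (hφ.continuous.comp (continuous_id.prodMk huc)).add continuous_const
  have hfM : ∀ θ, |f θ| ≤ M := fun θ => hM θ _
  have hfg : ∀ k, coeff f k = symbol L k * coeff g k := hcoeff u hgu
  obtain ⟨K, hK⟩ := hφ.exists_holder_comp hL F hC₁0 hC₁
  have hgv : g =ᵐ[torusMeasure n] potential L ρ f := hρ f hfc.measurable ⟨M, hfM⟩ hfg
  obtain ⟨C', -, hC'⟩ := exists_potential_holder (L := L) hρc.measurable hR hfc.measurable hfM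
  have huv : u = potential L ρ f := (huc.ae_eq_iff_eq (torusMeasure n)
    (continuous_of_continuous_lift hL.ne' (continuous_of_holder hC'))).1 (hgu.symm.trans hgv)
  obtain ⟨C, G, hC⟩ := exists_potential_taylor (L := L) hρc.measurable hR hfc.measurable hfM hK
  rw [← huv] at hC
  have hsmall := hasSmallSecondDiff_of_taylor hL.ne' hC
  obtain ⟨B, hB⟩ := isCompact_univ.exists_bound_of_continuousOn huc.continuousOn
  replace hB : ∀ θ, |u θ| ≤ B := fun θ => hB θ (Set.mem_univ θ)
  have hclass : IsClassicalSolution L φ F u := by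
    refine ⟨contDiff_one_of_taylor hC, hsmall.integrable_diffKernel huc hB, fun x => ?_⟩
    rw [hsmall.halfLaplacian_eq hL huc hB hfc (fun k => ?_) x, hf]
    · ring
    · rw [hfg k]
      congr 1
      exact mFourierCoeff_congr_ae (hgu.mono fun θ hθ => by simp only [hθ]) k
  exact ⟨u, hgu, hclass, hclass.isViscositySolution huc⟩
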